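/- Theorem 1. Fix $\gamma>0$ and let $$\psi_\gamma(x)=\frac{\sqrt{\gamma}}{\sqrt{2\pi}}\,\frac{e^{-\gamma|x|}}{|x|},\qquad x\in\mathbf{R}^3\setminus\{0\}.$$ Let $$\mathcal{F}=\{u\in L^2(\mathbf{R}^3,\psi_\gamma^2\,dx):\ \nabla u\in L^2(\mathbf{R}^3,\psi_\gamma^2\,dx)\},\qquad \mathcal{E}(u,v)=\frac12\int_{\mathbf{R}^3}\nabla u(x)\cdot\nabla v(x)\,\psi_\gamma(x)^2\,dx\quad(u,v\in\mathcal{F}),$$ where $\nabla u$ is the gradient of $u$ in the sense of distributions on $\mathbf{R}^3$. Then $(\mathcal{E},\mathcal{F})$ is a regular Dirichlet form on $L^2(\mathbf{R}^3,\psi_\gamma^2\,dx)$ with core $C_c^\infty(\mathbf{R}^3)$. That is: $m(dx)=\psi_\gamma(x)^2dx$ is a Radon measure with full support; $\mathcal{E}$ is a symmetric nonnegative definite bilinear form with domain $\mathcal{F}$ dense in $L^2(m)$; $\mathcal{F}$ is complete for the norm $\|u\|_{\mathcal{E}_1^{1/2}}=(\mathcal{E}(u,u)+(u,u)_m)^{1/2}$;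 for every $u\in\mathcal{F}$ the function $v=(0\vee u)\wedge 1$ is in $\mathcal{F}$ and $\mathcal{E}(v,v)\le\mathcal{E}(u,u)$; and $C_c^\infty(\mathbf{R}^3)$ is contained in $\mathcal{F}$, dense in $\mathcal{F}$ for the norm $\|\cdot\|_{\mathcal{E}_1^{1/2}}$, and dense in $C_c(\mathbf{R}^3)$ for the uniform norm. -/

import Mathlib

open MeasureTheory Filter Topology
open scoped ContDiff

/-! ## Dirichlet forms on `L²(X, μ)` -/

/-- A real bilinear form `(E, F)` on `L²(X, μ)`: a linear subspace `F` of `L²(X, μ)` together with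
a bilinear map `E : F × F → ℝ`. -/
structure L2Form {X : Type*} [MeasurableSpace X] (μ : Measure X) where
  /-- the domain `F` -/
  domain : Submodule ℝ (Lp ℝ 2 μ)
  /-- the form `E` -/
  form : domain →ₗ[ℝ] domain →ₗ[ℝ] ℝ

namespace L2Form

section Markov

variable {X : Type*} [MeasurableSpace X] {μ : Measure X}

/-- The quadratic form `E₁(u, u) = E(u, u) + (u, u)_μ`. -/
noncomputable def energyOne (F : L2Form μ) (u : F.domain) : ℝ :=
  F.form u u + inner ℝ (u : Lp ℝ 2 μ) (u : Lp ℝ 2 μ)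

/-- `(E, F)` is a Dirichlet form on `L²(X, μ)`: densely defined, symmetric, nonnegative definite,
closed (`F` is complete for the `E₁`-norm), and the unit contraction operates on it. -/
structure IsDirichletForm (F : L2Form μ) : Prop where
  dense : Dense (F.domain : Set (Lp ℝ 2 μ))
  symm : ∀ u v : F.domain, F.form u v = F.form v u
  nonneg : ∀ u : F.domain, 0 ≤ F.form u u
  closed : ∀ u : ℕ → F.domain,
    (∀ ε > 0, ∃ N, ∀ m ≥ N, ∀ n ≥ N, F.energyOne (u m - u n) < ε) →
      ∃ v : F.domain, Tendsto (fun n => F.energyOne (u n - v)) atTop (𝓝 0)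
  markov : ∀ u : F.domain, ∃ v : F.domain,
    ((v : Lp ℝ 2 μ) : X → ℝ) =ᵐ[μ] (fun x => min (max 0 ((u : Lp ℝ 2 μ) x)) 1) ∧
      F.form v v ≤ F.form u u

end Markov

section Regular

variable {X : Type*} [MetricSpace X] [LocallyCompactSpace X] [TopologicalSpace.SeparableSpace X]
  [MeasurableSpace X] [BorelSpace X] {μ : Measure X}

/-- A set `C` of functions is a core of `(E, F)`: it consists of continuous compactly supported
functions (whose classes are) in `F`, it is dense in `F` for the `E₁`-norm, and it is dense in
`C_c(X)` for the uniform norm. -/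
structure IsCore (F : L2Form μ) (C : Set (X → ℝ)) : Prop where
  continuous : ∀ f ∈ C, Continuous f
  hasCompactSupport : ∀ f ∈ C, HasCompactSupport f
  mem_domain : ∀ f ∈ C, ∃ u : F.domain, ((u : Lp ℝ 2 μ) : X → ℝ) =ᵐ[μ] f
  dense_domain : ∀ u : F.domain, ∀ ε > 0, ∃ f ∈ C, ∃ v : F.domain,
    ((v : Lp ℝ 2 μ) : X → ℝ) =ᵐ[μ] f ∧ F.energyOne (u - v) < ε
  dense_uniform : ∀ f : X → ℝ, Continuous f → HasCompactSupport f →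
    ∀ ε > 0, ∃ g ∈ C, ∀ x, |f x - g x| < ε

/-- `(E, F)` is a regular Dirichlet form on `L²(X, μ)`, where `X` is a locally compact separable
metric space: `μ` is a Radon measure with full support, and `(E, F)` is a Dirichlet form that
possesses a core. -/
structure IsRegularDirichletForm (F : L2Form μ) : Prop where
  radon : μ.Regular
  fullSupport : μ.IsOpenPosMeasure
  isDirichletForm : F.IsDirichletForm
  exists_core : ∃ C : Set (X → ℝ), F.IsCore C

end Regular

end L2Form

/-! ## Distributional gradients on `ℝ³` -/

/-- Euclidean space `ℝ³`. -/
abbrev R3 : Type := EuclideanSpace ℝ (Fin 3)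

/-- The class `C_c^∞(ℝ³)`. -/
def smoothCompactlySupported : Set (R3 → ℝ) :=
  {f | ContDiff ℝ ∞ f ∧ HasCompactSupport f}

/-- `g` is the gradient of `u` in the sense of distributions on `ℝ³` (Lebesgue measure). -/
structure IsWeakGradient (u : R3 → ℝ) (g : R3 → R3) : Prop where
  locallyIntegrable : LocallyIntegrable u volume
  locallyIntegrable_grad : LocallyIntegrable g volume
  integral_eq : ∀ φ ∈ smoothCompactlySupported, ∀ v : R3,
    ∫ x, u x * fderiv ℝ φ x v = - ∫ x, φ x * inner ℝ (g x) v

namespace IsWeakGradient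

lemma congr {u u' : R3 → ℝ} {g : R3 → R3} (h : IsWeakGradient u g) (hu : u =ᵐ[volume] u') :
    IsWeakGradient u' g where
  locallyIntegrable := h.locallyIntegrable.congr hu
  locallyIntegrable_grad := h.locallyIntegrable_grad
  integral_eq φ hφ v := by
    rw [← h.integral_eq φ hφ v]
    refine integral_congr_ae ?_
    filter_upwards [hu] with x hx
    rw [hx]

lemma integrable_left {u : R3 → ℝ} (hu : LocallyIntegrable u volume) {φ : R3 → ℝ}
    (hφ : φ ∈ smoothCompactlySupported) (v : R3) :
    Integrable (fun x => u x * fderiv ℝ φ x v) volume := by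
  have hc : Continuous (fun x => fderiv ℝ φ x v) :=
    (hφ.1.continuous_fderiv (by simp)).clm_apply continuous_const
  have hs : HasCompactSupport (fun x => fderiv ℝ φ x v) := hφ.2.fderiv_apply ℝ v
  simpa [mul_comm] using hu.integrable_smul_left_of_hasCompactSupport hc hs

lemma integrable_right {g : R3 → R3} (hg : LocallyIntegrable g volume) {φ : R3 → ℝ}
    (hφ : φ ∈ smoothCompactlySupported) (v : R3) :
    Integrable (fun x => φ x * inner ℝ (g x) v) volume := by
  have h := (hg.integrable_smul_left_of_hasCompactSupport hφ.1.continuous hφ.2).inner_const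
    (𝕜 := ℝ) v
  simpa [real_inner_smul_left] using h

lemma zero : IsWeakGradient 0 0 where
  locallyIntegrable := locallyIntegrable_zero
  locallyIntegrable_grad := locallyIntegrable_zero
  integral_eq φ _ v := by simp

lemma add {u₁ u₂ : R3 → ℝ} {g₁ g₂ : R3 → R3} (h₁ : IsWeakGradient u₁ g₁)
    (h₂ : IsWeakGradient u₂ g₂) : IsWeakGradient (u₁ + u₂) (g₁ + g₂) where
  locallyIntegrable := h₁.locallyIntegrable.add h₂.locallyIntegrable
  locallyIntegrable_grad := h₁.locallyIntegrable_grad.add h₂.locallyIntegrable_grad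
  integral_eq φ hφ v := by
    simp only [Pi.add_apply, add_mul, inner_add_left, mul_add]
    rw [integral_add (integrable_left h₁.locallyIntegrable hφ v)
        (integrable_left h₂.locallyIntegrable hφ v),
      integral_add (integrable_right h₁.locallyIntegrable_grad hφ v)
        (integrable_right h₂.locallyIntegrable_grad hφ v),
      h₁.integral_eq φ hφ v, h₂.integral_eq φ hφ v]
    ring

lemma smul {u : R3 → ℝ} {g : R3 → R3} (h : IsWeakGradient u g) (c : ℝ) :
    IsWeakGradient (c • u) (c • g) where
  locallyIntegrable := h.locallyIntegrable.smul c
  locallyIntegrable_grad := h.locallyIntegrable_grad.smul c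
  integral_eq φ hφ v := by
    have e₁ : ∀ x, (c • u) x * fderiv ℝ φ x v = c * (u x * fderiv ℝ φ x v) := fun x => by
      simp [mul_assoc]
    have e₂ : ∀ x, φ x * inner ℝ ((c • g) x) v = c * (φ x * inner ℝ (g x) v) := fun x => by
      simp only [Pi.smul_apply, real_inner_smul_left]; ring
    simp only [e₁, e₂, integral_const_mul, h.integral_eq φ hφ v]
    ring

/-- The distributional gradient is unique up to Lebesgue-null sets. -/
lemma unique {u : R3 → ℝ} {g₁ g₂ : R3 → R3} (h₁ : IsWeakGradient u g₁)
    (h₂ : IsWeakGradient u g₂) : g₁ =ᵐ[volume] g₂ := by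
  have hli : LocallyIntegrable (g₁ - g₂) volume :=
    h₁.locallyIntegrable_grad.sub h₂.locallyIntegrable_grad
  have key : ∀ᵐ x ∂(volume : Measure R3), (g₁ - g₂) x = 0 := by
    refine ae_eq_zero_of_integral_contDiff_smul_eq_zero hli fun φ hφ hφc => ?_
    have hmem : φ ∈ smoothCompactlySupported := ⟨hφ, hφc⟩
    refine ext_inner_right ℝ fun v => ?_
    have hint : Integrable (fun x => φ x • (g₁ - g₂) x) volume :=
      hli.integrable_smul_left_of_hasCompactSupport hφ.continuous hφc
    rw [inner_zero_left, real_inner_comm, ← integral_inner hint]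
    have e : ∀ x, inner ℝ v (φ x • (g₁ - g₂) x)
        = φ x * inner ℝ (g₁ x) v - φ x * inner ℝ (g₂ x) v := fun x => by
      rw [real_inner_comm, real_inner_smul_left, Pi.sub_apply, inner_sub_left, mul_sub]
    simp only [e]
    rw [integral_sub (integrable_right h₁.locallyIntegrable_grad hmem v)
      (integrable_right h₂.locallyIntegrable_grad hmem v)]
    linarith [h₁.integral_eq φ hmem v, h₂.integral_eq φ hmem v]
  filter_upwards [key] with x hx
  exact sub_eq_zero.mp hx

end IsWeakGradient

/-! ## The weighted energy form -/

/-- `ψ_γ(x) = √γ / √(2π) · exp(-γ|x|) / |x|`. -/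
noncomputable def psi (γ : ℝ) (x : R3) : ℝ :=
  Real.sqrt γ / Real.sqrt (2 * Real.pi) * (Real.exp (-γ * ‖x‖) / ‖x‖)

/-- The measure `m(dx) = ψ_γ(x)² dx` on `ℝ³`. -/
noncomputable def psiMeasure (γ : ℝ) : Measure R3 :=
  volume.withDensity fun x => ENNReal.ofReal (psi γ x ^ 2)

lemma measurable_psi (γ : ℝ) : Measurable (psi γ) := by
  unfold psi
  fun_prop

lemma volume_absolutelyContinuous_psiMeasure {γ : ℝ} (hγ : 0 < γ) :
    (volume : Measure R3) ≪ psiMeasure γ := by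
  refine withDensity_absolutelyContinuous' (by have := measurable_psi γ; fun_prop) ?_
  filter_upwards [Measure.ae_ne volume (0 : R3)] with x hx
  have : 0 < ‖x‖ := norm_pos_iff.mpr hx
  have : 0 < psi γ x := by unfold psi; positivity
  simp only [ne_eq, ENNReal.ofReal_eq_zero, not_le]
  positivity

lemma psiMeasure_absolutelyContinuous_volume (γ : ℝ) :
    psiMeasure γ ≪ (volume : Measure R3) :=
  withDensity_absolutelyContinuous _ _

/-- `F = {u ∈ L²(ℝ³, ψ_γ² dx) : ∇u ∈ L²(ℝ³, ψ_γ² dx)}`, with `∇u` in the sense of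
distributions. -/
noncomputable def weightedDomain (γ : ℝ) (hγ : 0 < γ) : Submodule ℝ (Lp ℝ 2 (psiMeasure γ)) where
  carrier := {u | ∃ g : R3 → R3, IsWeakGradient u g ∧ MemLp g 2 (psiMeasure γ)}
  zero_mem' := ⟨0, IsWeakGradient.zero.congr
    ((volume_absolutelyContinuous_psiMeasure hγ).ae_eq (Lp.coeFn_zero ℝ 2 _)).symm,
    MemLp.zero⟩
  add_mem' := by
    rintro u v ⟨g, hg, hg2⟩ ⟨k, hk, hk2⟩
    exact ⟨g + k, (hg.add hk).congr
      ((volume_absolutelyContinuous_psiMeasure hγ).ae_eq (Lp.coeFn_add u v)).symm, hg2.add hk2⟩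
  smul_mem' := by
    rintro c u ⟨g, hg, hg2⟩
    exact ⟨c • g, (hg.smul c).congr
      ((volume_absolutelyContinuous_psiMeasure hγ).ae_eq (Lp.coeFn_smul c u)).symm,
      hg2.const_smul c⟩

/-- The distributional gradient `∇u` of `u ∈ F` (unique up to null sets). -/
noncomputable def weakGradient {γ : ℝ} {hγ : 0 < γ} (u : weightedDomain γ hγ) : R3 → R3 :=
  Classical.choose u.2

section weakGradient

variable {γ : ℝ} {hγ : 0 < γ}

lemma weakGradient_spec (u : weightedDomain γ hγ) :
    IsWeakGradient (u : Lp ℝ 2 (psiMeasure γ)) (weakGradient u) :=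
  (Classical.choose_spec u.2).1

lemma memLp_weakGradient (u : weightedDomain γ hγ) :
    MemLp (weakGradient u) 2 (psiMeasure γ) :=
  (Classical.choose_spec u.2).2

lemma weakGradient_add (u v : weightedDomain γ hγ) :
    weakGradient (u + v) =ᵐ[psiMeasure γ] weakGradient u + weakGradient v :=
  (psiMeasure_absolutelyContinuous_volume γ).ae_eq <| (weakGradient_spec (u + v)).unique <|
    ((weakGradient_spec u).add (weakGradient_spec v)).congr
      ((volume_absolutelyContinuous_psiMeasure hγ).ae_eq
        (Lp.coeFn_add (u : Lp ℝ 2 (psiMeasure γ)) v)).symm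

lemma weakGradient_smul (c : ℝ) (u : weightedDomain γ hγ) :
    weakGradient (c • u) =ᵐ[psiMeasure γ] c • weakGradient u :=
  (psiMeasure_absolutelyContinuous_volume γ).ae_eq <| (weakGradient_spec (c • u)).unique <|
    ((weakGradient_spec u).smul c).congr
      ((volume_absolutelyContinuous_psiMeasure hγ).ae_eq
        (Lp.coeFn_smul c (u : Lp ℝ 2 (psiMeasure γ)))).symm

/-- `E(u, v) = ½ ∫ ∇u · ∇v ψ_γ² dx`. -/
noncomputable def weightedEnergy (u v : weightedDomain γ hγ) : ℝ :=
  (1 / 2) * ∫ x, inner ℝ (weakGradient u x) (weakGradient v x) ∂(psiMeasure γ)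

lemma integrable_inner_weakGradient (u v : weightedDomain γ hγ) :
    Integrable (fun x => inner ℝ (weakGradient u x) (weakGradient v x)) (psiMeasure γ) := by
  refine (L2.integrable_inner (𝕜 := ℝ) (memLp_weakGradient u).toLp
    (memLp_weakGradient v).toLp).congr ?_
  filter_upwards [(memLp_weakGradient u).coeFn_toLp, (memLp_weakGradient v).coeFn_toLp]
    with x hu hv
  rw [hu, hv]

lemma weightedEnergy_comm (u v : weightedDomain γ hγ) :
    weightedEnergy u v = weightedEnergy v u := by
  simp only [weightedEnergy, real_inner_comm]

lemma weightedEnergy_add_left (u v w : weightedDomain γ hγ) :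
    weightedEnergy (u + v) w = weightedEnergy u w + weightedEnergy v w := by
  unfold weightedEnergy
  rw [← mul_add, ← integral_add (integrable_inner_weakGradient u w)
    (integrable_inner_weakGradient v w)]
  congr 1
  refine integral_congr_ae ?_
  filter_upwards [weakGradient_add u v] with x hx
  rw [hx, Pi.add_apply, inner_add_left]

lemma weightedEnergy_smul_left (c : ℝ) (u w : weightedDomain γ hγ) :
    weightedEnergy (c • u) w = c * weightedEnergy u w := by
  unfold weightedEnergy
  rw [mul_left_comm, ← integral_const_mul c]
  congr 1
  refine integral_congr_ae ?_
  filter_upwards [weakGradient_smul c u] with x hx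
  rw [hx, Pi.smul_apply, real_inner_smul_left]

end weakGradient

/-- The energy form `(E, F)` on `L²(ℝ³, ψ_γ² dx)`. -/
noncomputable def weightedForm (γ : ℝ) (hγ : 0 < γ) : L2Form (psiMeasure γ) where
  domain := weightedDomain γ hγ
  form := LinearMap.mk₂ ℝ weightedEnergy weightedEnergy_add_left weightedEnergy_smul_left
    (fun u v w => by
      rw [weightedEnergy_comm u (v + w), weightedEnergy_add_left, weightedEnergy_comm v u,
        weightedEnergy_comm w u])
    (fun c u v => by
      rw [weightedEnergy_comm u (c • v), weightedEnergy_smul_left, weightedEnergy_comm v u,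
        smul_eq_mul])

open scoped ENNReal NNReal Convolution
open ContinuousLinearMap (lsmul)

/-! The weight is a constant times `exp (-2γ|x|) / |x|²`. It is bounded below on bounded sets, and
`m` is finite because the Jacobian `r²` of polar coordinates in dimension 3 cancels `|x|⁻²`. Hence
`L²(m)` embeds continuously into `L¹_loc`, so the distributional gradient is a closed operator on
`L²(m)` (`IsWeakGradient.of_tendsto_eLpNorm`); completeness of the domain follows.

The difficulty is density of test functions, since mollification may carry mass onto the singularity
at the origin. But averages of the weight at scale at most 1 are bounded by a fixed multiple of its
value at the centre (`lintegral_mollifier_mul_psi_sq_le`). By Jensen and Tonelli, mollification is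
then bounded on `L²(m)` uniformly in the scale (`exists_eLpNorm_mollify_le`), hence converges to the
identity there. It commutes with the gradient, so cutting off and then mollifying approximates every
function of the domain together with its gradient (`IsWeakGradient.exists_smooth_approx`).

This approximation also gives the chain rule for `C¹` functions with derivative bounded by 1. The
unit contraction is a limit of such functions whose derivatives tend pointwise to the indicator of
`(0, 1)`; closedness identifies the gradient of the contracted function as `∇u` where `0 < u < 1`
and 0 elsewhere, so the energy decreases. -/

/-! ### The weight: integrability and local lower bound. -/

lemma psi_sq (γ : ℝ) (hγ : 0 < γ) (x : R3) :
    psi γ x ^ 2 = γ / (2 * Real.pi) * (Real.exp (-(2 * γ) * ‖x‖) * (‖x‖ ^ 2)⁻¹) := by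
  unfold psi
  rw [mul_pow, div_pow, div_pow, Real.sq_sqrt hγ.le, Real.sq_sqrt (by positivity),
    ← Real.exp_nat_mul, div_eq_mul_inv (Real.exp _)]
  congr 3
  push_cast
  ring

lemma measurable_psi_sq (γ : ℝ) : Measurable fun x => ENNReal.ofReal (psi γ x ^ 2) := by
  have := measurable_psi γ
  fun_prop

/-- In polar coordinates the factor `r²` cancels the singularity, leaving a pure exponential. -/
lemma integrable_psi_sq {γ : ℝ} (hγ : 0 < γ) :
    Integrable (fun x : R3 => psi γ x ^ 2) volume := by
  simp only [psi_sq γ hγ]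
  refine (integrable_fun_norm_addHaar (E := R3) volume
    (f := fun r => γ / (2 * Real.pi) * (Real.exp (-(2 * γ) * r) * (r ^ 2)⁻¹))).2 ?_
  have h := (exp_neg_integrableOn_Ioi 0 (b := 2 * γ) (by positivity)).const_mul
    (γ / (2 * Real.pi))
  refine IntegrableOn.congr_fun h (fun r hr => ?_) measurableSet_Ioi
  have hr : 0 < r := hr
  simp only [finrank_euclideanSpace, Fintype.card_fin, smul_eq_mul]
  field_simp

lemma isFiniteMeasure_psiMeasure {γ : ℝ} (hγ : 0 < γ) : IsFiniteMeasure (psiMeasure γ) := by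
  refine isFiniteMeasure_withDensity ?_
  have := (integrable_psi_sq hγ).lintegral_lt_top
  exact this.ne

/-- The weight only decays at infinity, so it has a positive minimum on each ball; this converts
`m`-estimates into Lebesgue estimates on compact sets. -/
lemma restrict_closedBall_le_psiMeasure {γ : ℝ} (hγ : 0 < γ) (R : ℝ) :
    ∃ C : ℝ≥0, (volume : Measure R3).restrict (Metric.closedBall 0 R) ≤ C • psiMeasure γ := by
  rcases lt_or_ge R 0 with hR | hR
  · exact ⟨0, by simp [Metric.closedBall_eq_empty.2 hR]⟩
  -- A lower bound for the weight on the ball; `R + 1` replaces `R` so that it stays meaningful for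
  -- `R = 0`.
  set c := γ / (2 * Real.pi) * (Real.exp (-(2 * γ) * R) * ((R + 1) ^ 2)⁻¹)
  have hc : 0 < c := by positivity
  refine ⟨(Real.toNNReal c)⁻¹, ?_⟩
  rw [psiMeasure, ← Measure.coe_nnreal_smul, ← withDensity_smul _ (measurable_psi_sq γ),
    ← withDensity_indicator_one Metric.isClosed_closedBall.measurableSet]
  refine withDensity_mono ?_
  filter_upwards [Measure.ae_ne volume (0 : R3)] with x hx
  by_cases hxR : x ∈ Metric.closedBall (0 : R3) R
  · rw [Set.indicator_of_mem hxR]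
    have hx0 : 0 < ‖x‖ := norm_pos_iff.mpr hx
    have hxR' : ‖x‖ ≤ R := by simpa using hxR
    have h : c ≤ psi γ x ^ 2 := by
      rw [psi_sq γ hγ]
      have : Real.exp (-(2 * γ) * R) ≤ Real.exp (-(2 * γ) * ‖x‖) := by
        apply Real.exp_le_exp.2; nlinarith
      unfold c
      gcongr
      linarith
    have hcc : Real.toNNReal c ≠ 0 := by simpa using hc
    simp only [Pi.smul_apply, smul_eq_mul, Pi.one_apply]
    rw [ENNReal.coe_inv hcc, ← ENNReal.div_eq_inv_mul,
      ENNReal.le_div_iff_mul_le (by simp [hc]) (by simp), one_mul]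
    exact ENNReal.ofReal_le_ofReal h
  · simp [hxR]

/-- The radial integrand is `r² · r⁻² = 1` on `(0, ε]`, and `3 v` is the area of the unit sphere
when `v` is the volume of the unit ball. -/
lemma setLIntegral_closedBall_inv_norm_sq {ε : ℝ} (hε : 0 < ε) :
    ∫⁻ x in Metric.closedBall (0 : R3) ε, ENNReal.ofReal ((‖x‖ ^ 2)⁻¹) =
      ENNReal.ofReal (3 * (volume.real (Metric.ball (0 : R3) 1)) * ε) := by
  have hind : ∀ x : R3, (Metric.closedBall (0 : R3) ε).indicator
      (fun x => ENNReal.ofReal ((‖x‖ ^ 2)⁻¹)) x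
      = ENNReal.ofReal ((Set.Iic ε).indicator (fun r => (r ^ 2)⁻¹) ‖x‖) := by
    intro x
    by_cases h : ‖x‖ ≤ ε <;> simp [Set.indicator, h]
  have hcongr : ∀ r ∈ Set.Ioi (0 : ℝ), r ^ 2 • (Set.Iic ε).indicator (fun r => (r ^ 2)⁻¹) r
      = (Set.Ioc 0 ε).indicator (fun _ => (1 : ℝ)) r := by
    intro r (hr : 0 < r)
    by_cases h : r ≤ ε <;> simp [Set.indicator, h, hr, hr.ne']
  rw [← lintegral_indicator Metric.isClosed_closedBall.measurableSet]
  simp only [hind]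
  rw [← ofReal_integral_eq_lintegral_ofReal]
  · rw [integral_fun_norm_addHaar (E := R3) volume
      ((Set.Iic ε).indicator (fun r => (r ^ 2)⁻¹))]
    simp only [finrank_euclideanSpace, Fintype.card_fin, Nat.add_one_sub_one]
    rw [setIntegral_congr_fun measurableSet_Ioi hcongr,
      setIntegral_indicator measurableSet_Ioc]
    have : Set.Ioi (0 : ℝ) ∩ Set.Ioc 0 ε = Set.Ioc 0 ε := by
      ext; simp +contextual
    rw [this]
    simp [hε.le, mul_assoc]
  · refine (integrable_fun_norm_addHaar (E := R3) volume).2 ?_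
    simp only [finrank_euclideanSpace, Fintype.card_fin, Nat.add_one_sub_one]
    refine IntegrableOn.congr_fun ?_ (fun r hr => (hcongr r hr).symm) measurableSet_Ioi
    refine Integrable.integrableOn ?_
    rw [integrable_indicator_iff measurableSet_Ioc]
    exact integrableOn_const (by simp)
  · refine Eventually.of_forall fun x => ?_
    exact Set.indicator_nonneg (fun r _ => by positivity) _

/-! ### Averages of the weight under mollifiers. -/

/-- The mollifier supported in the ball of radius `1 / (n + 1)`. -/
noncomputable def mollifier (n : ℕ) : ContDiffBump (0 : R3) :=
  ⟨1 / (n + 1 : ℝ) / 2, 1 / (n + 1 : ℝ), by positivity, half_lt_self (by positivity)⟩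

/-- The weight `ψ_γ²` is of Muckenhoupt class `A₁` with respect to mollifiers. -/
lemma lintegral_mollifier_mul_psi_sq_le {γ : ℝ} (hγ : 0 < γ) :
    ∃ K : ℝ≥0, ∀ n, ∀ z : R3, z ≠ 0 →
      ∫⁻ y, ENNReal.ofReal ((mollifier n).normed volume y) * ENNReal.ofReal (psi γ (z + y) ^ 2) ≤
        K * ENNReal.ofReal (psi γ z ^ 2) := by
  -- `exp (2γ)` is the loss in the exponential under a shift of length at most 1. The 52 is `4 +
  -- 48`: 4 from the region where `|z + y| > ε`, and `48 = 16/(ε v) · 3 v ε` from the ball around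
  -- the singularity.
  refine ⟨Real.toNNReal (Real.exp (2 * γ) * 52), fun n z hz => ?_⟩
  set ε : ℝ := 1 / (n + 1 : ℝ) with hεdef
  have hε : 0 < ε := by positivity
  have hε1 : ε ≤ 1 := by
    rw [hεdef, div_le_one (by positivity)]; linarith [(Nat.cast_nonneg n : (0 : ℝ) ≤ n)]
  set v := volume.real (Metric.ball (0 : R3) 1) with hv
  have hvpos : 0 < v := ENNReal.toReal_pos (Metric.measure_ball_pos _ _ one_pos).ne'
    measure_ball_lt_top.ne
  set ρ := (mollifier n).normed (volume : Measure R3) with hρ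
  -- The outer radius is twice the inner one, whence the factor `2³ = 8`.
  have hρle : ∀ y, ρ y ≤ 8 / (ε ^ 3 * v) := by
    intro y
    have h := (mollifier n).normed_le_div_measure_closedBall_rOut volume 2
      (by simp [mollifier]; ring_nf; rfl) y
    have h2 : (mollifier n).rOut = ε := rfl
    rw [h2, Measure.addHaar_real_closedBall _ _ hε.le] at h
    simpa [← hv, show (2 : ℝ) ^ 3 = 8 by norm_num] using h
  have hρ0 : ∀ y, 0 ≤ ρ y := fun y => (mollifier n).nonneg_normed y
  have hz0 : 0 < ‖z‖ := norm_pos_iff.mpr hz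
  -- From `|z|² ≤ 2|z + y|² + 2ε²`, the ratio `|z|²/|z + y|²` is at most 4 away from the
  -- singularity; within distance `ε` of it, the excess `2ε²/|z + y|²` is integrable, and `ρ` is
  -- there replaced by its supremum.
  have hpt : ∀ y, ENNReal.ofReal (ρ y) * ENNReal.ofReal (psi γ (z + y) ^ 2) ≤
      ENNReal.ofReal (Real.exp (2 * γ) * psi γ z ^ 2) * (ENNReal.ofReal (4 * ρ y) +
        ENNReal.ofReal (16 / (ε * v)) * (Metric.closedBall (0 : R3) ε).indicator
          (fun x => ENNReal.ofReal ((‖x‖ ^ 2)⁻¹)) (z + y)) := by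
    intro y
    by_cases hy : ‖y‖ < ε
    swap
    · have : ρ y = 0 := by
        have hns : y ∉ Function.support ρ := by
          rw [hρ, ContDiffBump.support_normed_eq]
          simpa [mollifier, hεdef] using hy
        simpa using hns
      simp [this]
    have hexp : Real.exp (-(2 * γ) * ‖z + y‖) ≤
        Real.exp (2 * γ) * Real.exp (-(2 * γ) * ‖z‖) := by
      rw [← Real.exp_add]
      apply Real.exp_le_exp.2
      have : ‖z‖ ≤ ‖z + y‖ + ‖y‖ := by simpa using norm_sub_le (z + y) y
      nlinarith
    have hsq : ‖z‖ ^ 2 ≤ 2 * ‖z + y‖ ^ 2 + 2 * ε ^ 2 := by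
      have h1 : ‖z‖ ≤ ‖z + y‖ + ε := by
        have : ‖z‖ ≤ ‖z + y‖ + ‖y‖ := by simpa using norm_sub_le (z + y) y
        linarith
      nlinarith [sq_nonneg (‖z + y‖ - ε), norm_nonneg (z + y)]
    have hA : ∀ B : ℝ, (‖z + y‖ ^ 2)⁻¹ ≤ B * (‖z‖ ^ 2)⁻¹ → 0 ≤ B →
        psi γ (z + y) ^ 2 ≤ Real.exp (2 * γ) * psi γ z ^ 2 * B := by
      intro B hB hB0
      rw [psi_sq γ hγ, psi_sq γ hγ]
      calc _ ≤ γ / (2 * Real.pi) * ((Real.exp (2 * γ) * Real.exp (-(2 * γ) * ‖z‖)) *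
            (B * (‖z‖ ^ 2)⁻¹)) := by gcongr
        _ = _ := by ring
    rcases eq_or_ne (z + y) 0 with h0 | h0
    -- Division by zero gives `psi γ 0 = 0`, so the left side vanishes.
    · simp [h0, psi]
    have hzy : 0 < ‖z + y‖ := norm_pos_iff.mpr h0
    by_cases hb : ‖z + y‖ ≤ ε
    · have hmem : z + y ∈ Metric.closedBall (0 : R3) ε := by simpa using hb
      rw [Set.indicator_of_mem hmem, ← ENNReal.ofReal_mul (hρ0 y),
        ← ENNReal.ofReal_mul (p := 16 / (ε * v)) (by positivity),
        ← ENNReal.ofReal_add (by have := hρ0 y; positivity) (by positivity),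
        ← ENNReal.ofReal_mul (by positivity)]
      apply ENNReal.ofReal_le_ofReal
      have h1 := hA (4 + 2 * ε ^ 2 * (‖z + y‖ ^ 2)⁻¹) (by
        rw [← div_eq_mul_inv _ (‖z‖ ^ 2), le_div_iff₀ (by positivity), inv_mul_le_iff₀ (by positivity)]
        have : ‖z + y‖ ^ 2 * (4 + 2 * ε ^ 2 * (‖z + y‖ ^ 2)⁻¹) =
          4 * ‖z + y‖ ^ 2 + 2 * ε ^ 2 := by field_simp
        rw [this]; nlinarith [sq_nonneg ‖z + y‖]) (by positivity)
      calc ρ y * psi γ (z + y) ^ 2 ≤ ρ y * (Real.exp (2 * γ) * psi γ z ^ 2 *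
            (4 + 2 * ε ^ 2 * (‖z + y‖ ^ 2)⁻¹)) := by
            gcongr; exact hρ0 y
        _ = Real.exp (2 * γ) * psi γ z ^ 2 *
            (4 * ρ y + ρ y * (2 * ε ^ 2 * (‖z + y‖ ^ 2)⁻¹)) := by ring
        _ ≤ Real.exp (2 * γ) * psi γ z ^ 2 *
            (4 * ρ y + 8 / (ε ^ 3 * v) * (2 * ε ^ 2 * (‖z + y‖ ^ 2)⁻¹)) := by
            gcongr; exact hρle y
        _ = _ := by field_simp; ring
    · have hmem : z + y ∉ Metric.closedBall (0 : R3) ε := by simpa using hb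
      rw [Set.indicator_of_notMem hmem, mul_zero, add_zero,
        ← ENNReal.ofReal_mul (hρ0 y), ← ENNReal.ofReal_mul (by positivity)]
      apply ENNReal.ofReal_le_ofReal
      have h1 := hA 4 (by
        rw [← div_eq_mul_inv, le_div_iff₀ (by positivity), inv_mul_le_iff₀ (by positivity)]
        push Not at hb
        nlinarith) (by positivity)
      calc ρ y * psi γ (z + y) ^ 2 ≤ ρ y * (Real.exp (2 * γ) * psi γ z ^ 2 * 4) := by
            gcongr; exact hρ0 y
        _ = _ := by ring
  have hmeas : Measurable fun y => ENNReal.ofReal (4 * ρ y) := by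
    have : Continuous ρ := (mollifier n).continuous_normed
    fun_prop
  calc _ ≤ ∫⁻ y, ENNReal.ofReal (Real.exp (2 * γ) * psi γ z ^ 2) * (ENNReal.ofReal (4 * ρ y) +
        ENNReal.ofReal (16 / (ε * v)) * (Metric.closedBall (0 : R3) ε).indicator
          (fun x => ENNReal.ofReal ((‖x‖ ^ 2)⁻¹)) (z + y)) := lintegral_mono hpt
    _ = ENNReal.ofReal (Real.exp (2 * γ) * psi γ z ^ 2) * (ENNReal.ofReal 4 +
        ENNReal.ofReal (16 / (ε * v)) * ENNReal.ofReal (3 * v * ε)) := by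
      rw [lintegral_const_mul' _ _ (by simp), lintegral_add_left hmeas,
        lintegral_const_mul' _ _ (by simp), lintegral_add_left_eq_self
        ((Metric.closedBall (0 : R3) ε).indicator
          (fun x => ENNReal.ofReal ((‖x‖ ^ 2)⁻¹))),
        lintegral_indicator Metric.isClosed_closedBall.measurableSet,
        setLIntegral_closedBall_inv_norm_sq hε,
        ← ofReal_integral_eq_lintegral_ofReal (((mollifier n).integrable_normed).const_mul 4)
          (Eventually.of_forall fun y => by have := hρ0 y; simp only [Pi.zero_apply]; positivity),
        integral_const_mul, ContDiffBump.integral_normed, mul_one]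
    _ = ENNReal.ofReal (Real.exp (2 * γ) * 52) * ENNReal.ofReal (psi γ z ^ 2) := by
      rw [← ENNReal.ofReal_mul (by positivity), ← ENNReal.ofReal_add (by positivity) (by positivity),
        ← ENNReal.ofReal_mul (by positivity), ← ENNReal.ofReal_mul (by positivity)]
      congr 1
      field_simp
      ring
    _ = _ := rfl

/-! ### Tools for `L²` norms. -/

lemma eLpNorm_two_sq {X E : Type*} [MeasurableSpace X] [NormedAddCommGroup E] (μ : Measure X)
    (f : X → E) : eLpNorm f 2 μ ^ 2 = ∫⁻ x, ‖f x‖ₑ ^ 2 ∂μ := by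
  have := eLpNorm_nnreal_pow_eq_lintegral (μ := μ) (f := f) (p := 2) (by norm_num)
  simpa using this

/-- Dominated convergence in `L²`. -/
lemma tendsto_eLpNorm_two_of_dominated {X E : Type*} [MeasurableSpace X] [NormedAddCommGroup E]
    {μ : Measure X} {f : ℕ → X → E} {G : X → ℝ} (hf : ∀ n, AEStronglyMeasurable (f n) μ)
    (hG : MemLp G 2 μ) (hle : ∀ n, ∀ᵐ x ∂μ, ‖f n x‖ ≤ G x)
    (hlim : ∀ᵐ x ∂μ, Tendsto (fun n => f n x) atTop (𝓝 0)) :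
    Tendsto (fun n => eLpNorm (f n) 2 μ) atTop (𝓝 0) := by
  have h : Tendsto (fun n => ∫⁻ x, ‖f n x‖ₑ ^ 2 ∂μ) atTop (𝓝 (∫⁻ _, 0 ∂μ)) := by
    refine tendsto_lintegral_of_dominated_convergence' (fun x => ‖G x‖ₑ ^ 2)
      (fun n => (hf n).enorm.pow_const 2) (fun n => ?_) ?_ ?_
    · filter_upwards [hle n] with x hx
      gcongr
      rw [enorm_le_iff_norm_le]
      exact hx.trans (le_abs_self _)
    · rw [← eLpNorm_two_sq]
      exact ENNReal.pow_ne_top hG.eLpNorm_ne_top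
    · filter_upwards [hlim] with x hx
      have := (ENNReal.continuous_pow 2).tendsto _ |>.comp (hx.enorm)
      simpa [Function.comp_def] using this
  simp only [← eLpNorm_two_sq, lintegral_zero] at h
  have h2 := (ENNReal.continuous_rpow_const (y := 1 / 2)).tendsto _ |>.comp h
  refine (h2.congr fun n => ?_).trans (by simp)
  simp only [Function.comp]
  rw [← ENNReal.rpow_natCast, ← ENNReal.rpow_mul]
  norm_num

lemma eLpNorm_two_le_of_lintegral {X E F : Type*} [MeasurableSpace X] [NormedAddCommGroup E]
    [NormedAddCommGroup F] {μ : Measure X} {f : X → E} {g : X → F} {K : ℝ≥0∞}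
    (h : ∫⁻ x, ‖f x‖ₑ ^ 2 ∂μ ≤ K * ∫⁻ x, ‖g x‖ₑ ^ 2 ∂μ) :
    eLpNorm f 2 μ ≤ K ^ (1 / 2 : ℝ) * eLpNorm g 2 μ := by
  rw [← eLpNorm_two_sq, ← eLpNorm_two_sq] at h
  have h2 := ENNReal.rpow_le_rpow h (show (0 : ℝ) ≤ 1 / 2 by norm_num)
  rw [ENNReal.mul_rpow_of_nonneg _ _ (by norm_num), ← ENNReal.rpow_natCast,
    ← ENNReal.rpow_natCast, ← ENNReal.rpow_mul, ← ENNReal.rpow_mul] at h2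
  simpa using h2

lemma sq_lintegral_le_lintegral_sq {X : Type*} [MeasurableSpace X] (ν : Measure X)
    [IsProbabilityMeasure ν] {f : X → ℝ≥0∞} (hf : AEMeasurable f ν) :
    (∫⁻ x, f x ∂ν) ^ 2 ≤ ∫⁻ x, f x ^ 2 ∂ν := by
  have h := ENNReal.lintegral_mul_le_Lp_mul_Lq ν Real.HolderConjugate.two_two hf
    (aemeasurable_const (b := (1 : ℝ≥0∞)))
  simp only [Pi.mul_apply, mul_one, ENNReal.one_rpow, lintegral_const, measure_univ] at h
  calc _ ≤ ((∫⁻ x, f x ^ (2 : ℝ) ∂ν) ^ (1 / 2 : ℝ)) ^ 2 := by gcongr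
    _ = _ := by
      rw [← ENNReal.rpow_natCast, ← ENNReal.rpow_mul]
      simp

/-! ### Mollification on the weighted `L²` space. -/

section mollify

variable {E : Type*} [NormedAddCommGroup E] [NormedSpace ℝ E]

/-- The mollification `ρ_n ⋆ F`. -/
noncomputable def mollify (n : ℕ) (F : R3 → E) : R3 → E :=
  ((mollifier n).normed volume) ⋆[lsmul ℝ ℝ, volume] F

lemma contDiff_mollify [CompleteSpace E] (n : ℕ) {F : R3 → E} (hF : LocallyIntegrable F volume) :
    ContDiff ℝ ∞ (mollify n F) :=
  (mollifier n).hasCompactSupport_normed.contDiff_convolution_left _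
    (mollifier n).contDiff_normed hF

lemma HasCompactSupport.mollify {F : R3 → E} (hF : HasCompactSupport F) (n : ℕ) :
    HasCompactSupport (mollify n F) :=
  (mollifier n).hasCompactSupport_normed.convolution _ hF

lemma mollify_congr {F G : R3 → E} (h : F =ᵐ[volume] G) (n : ℕ) : mollify n F = mollify n G :=
  convolution_congr _ (Filter.EventuallyEq.refl _ _) h

lemma mollify_add {F G : R3 → E} (hF : LocallyIntegrable F volume)
    (hG : LocallyIntegrable G volume) (n : ℕ) :
    mollify n (F + G) = mollify n F + mollify n G :=
  ConvolutionExists.distrib_add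
    ((mollifier n).hasCompactSupport_normed.convolutionExists_left _
      (mollifier n).continuous_normed hF)
    ((mollifier n).hasCompactSupport_normed.convolutionExists_left _
      (mollifier n).continuous_normed hG)

/-- Jensen's inequality for the probability measure whose density is the mollifier. -/
lemma enorm_mollify_sq_le {F : R3 → E} (hF : StronglyMeasurable F) (n : ℕ) (x : R3) :
    ‖mollify n F x‖ₑ ^ 2 ≤
      ∫⁻ y, ENNReal.ofReal ((mollifier n).normed volume y) * ‖F (x - y)‖ₑ ^ 2 := by
  set k : R3 → ℝ≥0∞ := fun y => ENNReal.ofReal ((mollifier n).normed volume y)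
  have hk : Measurable k := by
    have : Continuous ((mollifier n).normed (volume : Measure R3)) :=
      (mollifier n).continuous_normed
    fun_prop
  have hprob : IsProbabilityMeasure ((volume : Measure R3).withDensity k) := by
    refine ⟨?_⟩
    rw [withDensity_apply _ MeasurableSet.univ, setLIntegral_univ]
    rw [← ofReal_integral_eq_lintegral_ofReal (mollifier n).integrable_normed
      (Eventually.of_forall fun y => (mollifier n).nonneg_normed y),
      ContDiffBump.integral_normed, ENNReal.ofReal_one]
  have hFm : Measurable fun y => ‖F (x - y)‖ₑ :=
    hF.enorm.comp (measurable_const.sub measurable_id)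
  have h1 : ‖mollify n F x‖ₑ ≤ ∫⁻ y, ‖F (x - y)‖ₑ ∂((volume : Measure R3).withDensity k) := by
    rw [lintegral_withDensity_eq_lintegral_mul _ hk hFm]
    refine (enorm_integral_le_lintegral_enorm _).trans_eq (lintegral_congr fun y => ?_)
    simp only [ContinuousLinearMap.lsmul_apply, enorm_smul, Pi.mul_apply, k]
    rw [Real.enorm_of_nonneg ((mollifier n).nonneg_normed y)]
  calc _ ≤ (∫⁻ y, ‖F (x - y)‖ₑ ∂((volume : Measure R3).withDensity k)) ^ 2 := by gcongr
    _ ≤ ∫⁻ y, ‖F (x - y)‖ₑ ^ 2 ∂((volume : Measure R3).withDensity k) :=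
      sq_lintegral_le_lintegral_sq _ hFm.aemeasurable
    _ = _ := lintegral_withDensity_eq_lintegral_mul _ hk (hFm.pow_const 2)

lemma lintegral_psiMeasure (γ : ℝ) {f : R3 → ℝ≥0∞} (hf : Measurable f) :
    ∫⁻ x, f x ∂(psiMeasure γ) = ∫⁻ x, ENNReal.ofReal (psi γ x ^ 2) * f x :=
  lintegral_withDensity_eq_lintegral_mul _ (measurable_psi_sq γ) hf

/-- Mollification is bounded on `L²(ψ_γ² dx)`, uniformly in the mollifier. -/
lemma exists_eLpNorm_mollify_le (E : Type*) [NormedAddCommGroup E] [NormedSpace ℝ E]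
    [CompleteSpace E] {γ : ℝ} (hγ : 0 < γ) :
    ∃ K : ℝ≥0, ∀ n, ∀ F : R3 → E, LocallyIntegrable F volume →
      eLpNorm (mollify n F) 2 (psiMeasure γ) ≤ K * eLpNorm F 2 (psiMeasure γ) := by
  obtain ⟨K, hK⟩ := lintegral_mollifier_mul_psi_sq_le hγ
  refine ⟨K ^ (1 / 2 : ℝ), fun n F hF => ?_⟩
  -- Tonelli below needs a genuinely measurable representative; the mollification does not see the
  -- change.
  set F' := hF.aestronglyMeasurable.mk F
  have hF' : StronglyMeasurable F' := hF.aestronglyMeasurable.stronglyMeasurable_mk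
  have hFF' : F =ᵐ[volume] F' := hF.aestronglyMeasurable.ae_eq_mk
  rw [mollify_congr hFF', eLpNorm_congr_ae ((psiMeasure_absolutelyContinuous_volume γ).ae_eq hFF'),
    ENNReal.coe_rpow_of_nonneg _ (by norm_num)]
  refine eLpNorm_two_le_of_lintegral ?_
  set k : R3 → ℝ≥0∞ := fun y => ENNReal.ofReal ((mollifier n).normed volume y)
  have hk : Measurable k := by
    have : Continuous ((mollifier n).normed (volume : Measure R3)) :=
      (mollifier n).continuous_normed
    fun_prop
  have hcont : Measurable fun x => ‖mollify n F' x‖ₑ ^ 2 :=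
    ((contDiff_mollify n (hF.congr hFF')).continuous.enorm.measurable).pow_const 2
  have hW := measurable_psi_sq γ
  have hN : Measurable fun x => ‖F' x‖ₑ ^ 2 := hF'.enorm.pow_const 2
  set W : R3 → ℝ≥0∞ := fun x => ENNReal.ofReal (psi γ x ^ 2)
  set N : R3 → ℝ≥0∞ := fun x => ‖F' x‖ₑ ^ 2
  rw [lintegral_psiMeasure γ hcont, lintegral_psiMeasure γ hN]
  -- After Jensen, Tonelli and the translation `x = z + y` transfer the average from `F'` to the
  -- weight, where the bound `hK` applies.
  calc ∫⁻ x, W x * ‖mollify n F' x‖ₑ ^ 2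
      ≤ ∫⁻ x, W x * ∫⁻ y, k y * N (x - y) :=
        lintegral_mono fun x => by gcongr; exact enorm_mollify_sq_le hF' n x
    _ = ∫⁻ x, ∫⁻ y, W x * (k y * N (x - y)) := by
        refine lintegral_congr fun x => ?_
        rw [lintegral_const_mul]
        exact hk.mul (hN.comp (measurable_const.sub measurable_id))
    _ = ∫⁻ y, ∫⁻ x, W x * (k y * N (x - y)) := by
        refine lintegral_lintegral_swap (Measurable.aemeasurable ?_)
        exact (hW.comp measurable_fst).mul ((hk.comp measurable_snd).mul
          (hN.comp (measurable_fst.sub measurable_snd)))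
    _ = ∫⁻ y, ∫⁻ z, W (z + y) * (k y * N z) := by
        refine lintegral_congr fun y => ?_
        rw [← lintegral_add_right_eq_self _ y]
        simp
    _ = ∫⁻ z, ∫⁻ y, W (z + y) * (k y * N z) := by
        refine lintegral_lintegral_swap (Measurable.aemeasurable ?_)
        exact (hW.comp (measurable_snd.add measurable_fst)).mul ((hk.comp measurable_fst).mul
          (hN.comp measurable_snd))
    _ = ∫⁻ z, N z * ∫⁻ y, k y * W (z + y) := by
        refine lintegral_congr fun z => ?_
        rw [← lintegral_const_mul]
        · refine lintegral_congr fun y => ?_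
          ring
        · exact hk.mul (hW.comp (measurable_const.add measurable_id))
    _ ≤ ∫⁻ z, N z * (K * W z) := by
        refine lintegral_mono_ae ?_
        filter_upwards [Measure.ae_ne volume (0 : R3)] with z hz
        gcongr
        exact hK n z hz
    _ = K * ∫⁻ z, W z * N z := by
        have hWN : Measurable fun z => W z * N z := hW.mul hN
        rw [← lintegral_const_mul _ hWN]
        refine lintegral_congr fun z => ?_
        ring

/-- Uniform continuity of `h` suffices once the mollifier's support is small. This serves both the
`L²` convergence and the uniform density in `C_c`. -/
lemma exists_dist_mollify_le [CompleteSpace E] {h : R3 → E} (hc : Continuous h)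
    (hs : HasCompactSupport h) {δ : ℝ} (hδ : 0 < δ) :
    ∀ᶠ n in atTop, ∀ x, dist (mollify n h x) (h x) ≤ δ := by
  obtain ⟨η, hη, hu⟩ := Metric.uniformContinuous_iff.1 (hs.uniformContinuous_of_continuous hc) δ hδ
  have hlim := tendsto_one_div_add_atTop_nhds_zero_nat (𝕜 := ℝ)
  filter_upwards [hlim.eventually_lt_const hη] with n hn x
  refine ContDiffBump.dist_normed_convolution_le hc.aestronglyMeasurable fun y hy => ?_
  have : dist y x < 1 / ((n : ℝ) + 1) := hy
  exact (hu (this.trans hn)).le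

/-- Convergence holds uniformly on smooth compactly supported functions, which are dense, and passes
to all of `L²(m)` by the uniform bound `K`. -/
lemma tendsto_eLpNorm_mollify_sub [CompleteSpace E] {γ : ℝ} (hγ : 0 < γ) {F : R3 → E}
    (hF : LocallyIntegrable F volume) (hF2 : MemLp F 2 (psiMeasure γ)) :
    Tendsto (fun n => eLpNorm (mollify n F - F) 2 (psiMeasure γ)) atTop (𝓝 0) := by
  have := isFiniteMeasure_psiMeasure hγ
  obtain ⟨K, hK⟩ := exists_eLpNorm_mollify_le E hγ
  -- As `m` is finite, a uniform error `δ` costs at most `M δ` in `L²(m)`; the total error is `(K +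
  -- M + 1) δ`.
  set M : ℝ≥0 := (psiMeasure γ Set.univ ^ (1 / 2 : ℝ)).toNNReal
  have hM : (M : ℝ≥0∞) = psiMeasure γ Set.univ ^ (1 / 2 : ℝ) := by
    rw [ENNReal.coe_toNNReal]
    exact (ENNReal.rpow_lt_top_of_nonneg (by norm_num) (measure_ne_top _ _)).ne
  have hlim : Tendsto (fun δ : ℝ => ENNReal.ofReal (K * δ + M * δ + δ)) (𝓝[>] 0) (𝓝 0) := by
    have : Tendsto (fun δ : ℝ => K * δ + M * δ + δ) (𝓝[>] 0) (𝓝 (K * 0 + M * 0 + 0)) :=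
      (Continuous.tendsto (by fun_prop) 0).mono_left nhdsWithin_le_nhds
    simpa using ENNReal.tendsto_ofReal this
  rw [ENNReal.tendsto_atTop_zero]
  intro ε hε
  obtain ⟨δ, hδε, hδ⟩ := ((hlim.eventually_le_const hε).and self_mem_nhdsWithin).exists
  have hδ : 0 < δ := hδ
  obtain ⟨h, hs, hcd, hFh⟩ := hF2.exist_eLpNorm_sub_le (by norm_num) (by norm_num) hδ
  have hc := hcd.continuous
  obtain ⟨N, hN⟩ := eventually_atTop.1 (exists_dist_mollify_le hc hs hδ)
  refine ⟨N, fun n hn => le_trans ?_ hδε⟩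
  have hli : LocallyIntegrable h volume := hc.locallyIntegrable
  have hdec : mollify n F - F = mollify n (F - h) + ((mollify n h - h) + (h - F)) := by
    have : F = (F - h) + h := by abel
    rw [congrArg (mollify n) this, mollify_add (hF.sub hli) hli]
    abel
  have m1 : AEStronglyMeasurable (mollify n (F - h)) (psiMeasure γ) :=
    (contDiff_mollify n (hF.sub hli)).continuous.aestronglyMeasurable
  have m2 : AEStronglyMeasurable (mollify n h - h) (psiMeasure γ) :=
    ((contDiff_mollify n hli).continuous.sub hc).aestronglyMeasurable
  have m3 : AEStronglyMeasurable (h - F) (psiMeasure γ) :=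
    hc.aestronglyMeasurable.sub hF2.aestronglyMeasurable
  have e2 : eLpNorm (mollify n h - h) 2 (psiMeasure γ) ≤ M * ENNReal.ofReal δ := by
    refine (eLpNorm_le_of_ae_bound (C := δ) (Eventually.of_forall fun x => ?_)).trans_eq ?_
    · have := hN n hn x
      rwa [dist_eq_norm] at this
    · rw [hM]; norm_num
  rw [hdec]
  calc _ ≤ _ + (_ + _) := (eLpNorm_add_le m1 (m2.add m3) (by norm_num)).trans
        (add_le_add le_rfl (eLpNorm_add_le m2 m3 (by norm_num)))
    _ ≤ K * ENNReal.ofReal δ + (M * ENNReal.ofReal δ + ENNReal.ofReal δ) := by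
      gcongr
      · exact (hK n _ (hF.sub hli)).trans (by gcongr)
      · rwa [eLpNorm_sub_comm]
    _ = _ := by
      rw [ENNReal.ofReal_add (by positivity) hδ.le, ENNReal.ofReal_add (by positivity)
        (by positivity), ENNReal.ofReal_mul (by positivity), ENNReal.ofReal_mul (by positivity)]
      simp [add_assoc]

end mollify

/-! ### Comparison of weighted `L²` with Lebesgue integration. -/

section weighted

variable {E : Type*} [NormedAddCommGroup E] {γ : ℝ}

/-- `L²(m) ⊆ L¹(m)` since `m` is finite, and `m` dominates Lebesgue measure on balls up to a
constant. -/
lemma locallyIntegrable_of_memLp_psiMeasure (hγ : 0 < γ) {F : R3 → E}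
    (hF : MemLp F 2 (psiMeasure γ)) : LocallyIntegrable F volume := by
  have := isFiniteMeasure_psiMeasure hγ
  rw [locallyIntegrable_iff]
  intro K hK
  obtain ⟨R, hR⟩ := hK.isBounded.subset_closedBall 0
  obtain ⟨C, hC⟩ := restrict_closedBall_le_psiMeasure hγ R
  have h1 : Integrable F (psiMeasure γ) := hF.integrable (by norm_num)
  have h2 : Integrable F (C • psiMeasure γ) := h1.smul_measure_nnreal
  have h3 : IntegrableOn F (Metric.closedBall 0 R) volume := h2.mono_measure hC
  exact h3.mono_set hR

/-- Integrals against compactly supported functions are continuous on `L²(ψ_γ² dx)`. -/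
lemma exists_enorm_integral_le (E : Type*) [NormedAddCommGroup E] (hγ : 0 < γ) {θ : R3 → ℝ}
    (hc : Continuous θ) (hs : HasCompactSupport θ) :
    ∃ C : ℝ≥0, ∀ (Φ : R3 → ℝ) (F : R3 → E), AEStronglyMeasurable F (psiMeasure γ) →
      (∀ x, ‖Φ x‖ ≤ ‖θ x‖ * ‖F x‖) → ‖∫ x, Φ x‖ₑ ≤ C * eLpNorm F 2 (psiMeasure γ) := by
  have := isFiniteMeasure_psiMeasure hγ
  obtain ⟨R, hR⟩ := hs.isCompact.isBounded.subset_closedBall 0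
  obtain ⟨C, hC⟩ := restrict_closedBall_le_psiMeasure hγ R
  obtain ⟨B, hB⟩ := hs.exists_bound_of_continuous hc
  set M : ℝ≥0 := (psiMeasure γ Set.univ ^ (1 / 2 : ℝ)).toNNReal
  have hM : (M : ℝ≥0∞) = psiMeasure γ Set.univ ^ (1 / 2 : ℝ) := by
    rw [ENNReal.coe_toNNReal]
    exact (ENNReal.rpow_lt_top_of_nonneg (by norm_num) (measure_ne_top _ _)).ne
  -- `B` bounds `θ`, `C` compares Lebesgue measure on the ball with `m`, and `M` passes from `L¹(m)`
  -- to `L²(m)`.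
  refine ⟨B.toNNReal * (C * M), fun Φ F hF hle => ?_⟩
  have hpt : ∀ x, ‖Φ x‖ₑ ≤ (Metric.closedBall (0 : R3) R).indicator
      (fun x => (B.toNNReal : ℝ≥0∞) * ‖F x‖ₑ) x := by
    intro x
    by_cases hx : x ∈ Metric.closedBall (0 : R3) R
    · rw [Set.indicator_of_mem hx]
      have h1 : ‖Φ x‖ ≤ B * ‖F x‖ := (hle x).trans (by gcongr; exact hB x)
      have hB0 : 0 ≤ B := (norm_nonneg _).trans (hB x)
      rw [← ofReal_norm, ← ofReal_norm, ← ENNReal.ofReal, ← ENNReal.ofReal_mul hB0]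
      exact ENNReal.ofReal_le_ofReal h1
    · have h0 : θ x = 0 := image_eq_zero_of_notMem_tsupport fun h => hx (hR h)
      have : Φ x = 0 := by
        have := hle x
        rw [h0] at this
        simpa using this
      simp [this]
  calc ‖∫ x, Φ x‖ₑ ≤ ∫⁻ x, ‖Φ x‖ₑ := enorm_integral_le_lintegral_enorm _
    _ ≤ ∫⁻ x, (Metric.closedBall (0 : R3) R).indicator
        (fun x => (B.toNNReal : ℝ≥0∞) * ‖F x‖ₑ) x := lintegral_mono hpt
    _ = B.toNNReal * ∫⁻ x in Metric.closedBall (0 : R3) R, ‖F x‖ₑ := by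
      rw [lintegral_indicator Metric.isClosed_closedBall.measurableSet,
        lintegral_const_mul' _ _ (by simp)]
    _ ≤ B.toNNReal * ∫⁻ x, ‖F x‖ₑ ∂(C • psiMeasure γ) := by
      gcongr
    _ = B.toNNReal * (C * eLpNorm F 1 (psiMeasure γ)) := by
      rw [eLpNorm_one_eq_lintegral_enorm, lintegral_smul_measure]
      rfl
    _ ≤ B.toNNReal * (C * (eLpNorm F 2 (psiMeasure γ) * M)) := by
      gcongr
      refine (eLpNorm_le_eLpNorm_mul_rpow_measure_univ (p := 1) (q := 2) (by norm_num) hF).trans ?_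
      rw [hM]; norm_num
    _ = _ := by push_cast; ring

end weighted

/-! ### Closedness and calculus of the distributional gradient. -/

namespace IsWeakGradient

/-- The distributional gradient is a closed operator on `L²(ψ_γ² dx)`. -/
lemma of_tendsto_eLpNorm {γ : ℝ} (hγ : 0 < γ) {u : ℕ → R3 → ℝ} {g : ℕ → R3 → R3} {u₀ : R3 → ℝ}
    {g₀ : R3 → R3} (h : ∀ n, IsWeakGradient (u n) (g n))
    (hu₀ : MemLp u₀ 2 (psiMeasure γ)) (hg₀ : MemLp g₀ 2 (psiMeasure γ))
    (hu : Tendsto (fun n => eLpNorm (u n - u₀) 2 (psiMeasure γ)) atTop (𝓝 0))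
    (hg : Tendsto (fun n => eLpNorm (g n - g₀) 2 (psiMeasure γ)) atTop (𝓝 0)) :
    IsWeakGradient u₀ g₀ := by
  have hu₀l := locallyIntegrable_of_memLp_psiMeasure hγ hu₀
  have hg₀l := locallyIntegrable_of_memLp_psiMeasure hγ hg₀
  refine ⟨hu₀l, hg₀l, fun φ hφ v => ?_⟩
  have hac := psiMeasure_absolutelyContinuous_volume γ
  obtain ⟨C₁, hC₁⟩ := exists_enorm_integral_le ℝ hγ (θ := fun x => fderiv ℝ φ x v)
    ((hφ.1.continuous_fderiv (by simp)).clm_apply continuous_const) (hφ.2.fderiv_apply ℝ v)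
  obtain ⟨C₂, hC₂⟩ := exists_enorm_integral_le R3 hγ (θ := fun x => φ x * ‖v‖)
    (hφ.1.continuous.mul continuous_const) hφ.2.mul_right
  -- The defect in the integration by parts formula for the limit pair does not depend on `n`. The
  -- formula holds for `u n`, so up to sign this is the defect of the differences, which tends to 0.
  have key : ∀ n, ‖(∫ x, u₀ x * fderiv ℝ φ x v) + ∫ x, φ x * inner ℝ (g₀ x) v‖ₑ ≤
      C₁ * eLpNorm (u n - u₀) 2 (psiMeasure γ) + C₂ * eLpNorm (g n - g₀) 2 (psiMeasure γ) := by
    intro n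
    have e1 : (∫ x, u₀ x * fderiv ℝ φ x v) + ∫ x, φ x * inner ℝ (g₀ x) v =
        -((∫ x, (u n - u₀) x * fderiv ℝ φ x v) + ∫ x, φ x * inner ℝ ((g n - g₀) x) v) := by
      simp only [Pi.sub_apply, sub_mul, inner_sub_left, mul_sub]
      rw [integral_sub (integrable_left (h n).locallyIntegrable hφ v)
          (integrable_left hu₀l hφ v),
        integral_sub (integrable_right (h n).locallyIntegrable_grad hφ v)
          (integrable_right hg₀l hφ v), (h n).integral_eq φ hφ v]
      ring
    rw [e1, enorm_neg]
    refine (enorm_add_le _ _).trans (add_le_add ?_ ?_)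
    · refine hC₁ _ _ (((h n).locallyIntegrable.aestronglyMeasurable.mono_ac hac).sub
        hu₀.aestronglyMeasurable) fun x => ?_
      rw [norm_mul, mul_comm]
    · refine hC₂ _ _ (((h n).locallyIntegrable_grad.aestronglyMeasurable.mono_ac hac).sub
        hg₀.aestronglyMeasurable) fun x => ?_
      rw [norm_mul, norm_mul, norm_norm, mul_assoc, mul_comm ‖v‖]
      gcongr
      exact norm_inner_le_norm _ _
  have hlim : Tendsto (fun n => C₁ * eLpNorm (u n - u₀) 2 (psiMeasure γ) +
      C₂ * eLpNorm (g n - g₀) 2 (psiMeasure γ)) atTop (𝓝 (C₁ * 0 + C₂ * 0)) :=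
    (ENNReal.Tendsto.const_mul hu (by simp)).add (ENNReal.Tendsto.const_mul hg (by simp))
  simp only [mul_zero, add_zero] at hlim
  have h0 := ge_of_tendsto' hlim key
  have h1 : (∫ x, u₀ x * fderiv ℝ φ x v) + ∫ x, φ x * inner ℝ (g₀ x) v = 0 := by
    simpa using h0
  linarith

lemma _root_.ContDiff.continuous_gradient {f : R3 → ℝ} (hf : ContDiff ℝ 1 f) :
    Continuous (gradient f) :=
  (InnerProductSpace.toDual ℝ R3).symm.continuous.comp (hf.continuous_fderiv one_ne_zero)

lemma of_contDiff {f : R3 → ℝ} (hf : ContDiff ℝ 1 f) : IsWeakGradient f (gradient f) where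
  locallyIntegrable := hf.continuous.locallyIntegrable
  locallyIntegrable_grad := hf.continuous_gradient.locallyIntegrable
  integral_eq φ hφ v := by
    simp only [inner_gradient_left]
    have h2 : Continuous fun x => fderiv ℝ f x v :=
      (hf.continuous_fderiv one_ne_zero).clm_apply continuous_const
    rw [integral_mul_fderiv_eq_neg_fderiv_mul_of_integrable]
    · simp only [mul_comm]
    · exact (h2.mul hφ.1.continuous).integrable_of_hasCompactSupport hφ.2.mul_left
    · exact integrable_left hf.continuous.locallyIntegrable hφ v
    · exact (hf.continuous.mul hφ.1.continuous).integrable_of_hasCompactSupport hφ.2.mul_left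
    · exact fun x _ => (hf.differentiable one_ne_zero) x
    · exact fun x _ => (hφ.1.differentiable (by simp)) x

/-- The product rule. -/
lemma smooth_mul {u : R3 → ℝ} {g : R3 → R3} (h : IsWeakGradient u g) {χ : R3 → ℝ}
    (hχ : ContDiff ℝ ∞ χ) :
    IsWeakGradient (fun x => χ x * u x) (fun x => χ x • g x + u x • gradient χ x) := by
  have hχ1 : ContDiff ℝ 1 χ := hχ.of_le (by simp)
  have hχc := hχ.continuous
  have hgc := hχ1.continuous_gradient
  have l1 : LocallyIntegrable (fun x => χ x * u x) volume := by
    have := h.locallyIntegrable.continuous_smul hχc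
    exact this
  have l2 : LocallyIntegrable (fun x => χ x • g x) volume :=
    h.locallyIntegrable_grad.continuous_smul hχc
  have l3 : LocallyIntegrable (fun x => u x • gradient χ x) volume :=
    h.locallyIntegrable.smul_continuous hgc
  refine ⟨l1, l2.add l3, fun φ hφ v => ?_⟩
  -- The formula for `u` is tested against `χ φ`, and the Leibniz rule moves the term with `∇χ` to
  -- the other side.
  have hφχ : (fun x => χ x * φ x) ∈ smoothCompactlySupported :=
    ⟨hχ.mul hφ.1, hφ.2.mul_left⟩
  have key := h.integral_eq _ hφχ v
  have hd : ∀ x, fderiv ℝ (fun x => χ x * φ x) x v =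
      χ x * fderiv ℝ φ x v + φ x * inner ℝ (gradient χ x) v := by
    intro x
    rw [fderiv_fun_mul (hχ.differentiable (by simp) x) (hφ.1.differentiable (by simp) x),
      inner_gradient_left]
    simp
  have e1 : ∀ x, u x * fderiv ℝ (fun x => χ x * φ x) x v =
      χ x * u x * fderiv ℝ φ x v + φ x * inner ℝ (u x • gradient χ x) v := by
    intro x
    rw [hd, real_inner_smul_left]; ring
  have e2 : ∀ x, φ x * inner ℝ (χ x • g x + u x • gradient χ x) v =
      χ x * φ x * inner ℝ (g x) v + φ x * inner ℝ (u x • gradient χ x) v := by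
    intro x
    rw [inner_add_left, real_inner_smul_left]; ring
  simp only [e1] at key
  rw [integral_add (integrable_left l1 hφ v) (integrable_right l3 hφ v)] at key
  simp only [e2]
  rw [integral_add (integrable_right h.locallyIntegrable_grad hφχ v) (integrable_right l3 hφ v)]
  linarith

/-- Mollification commutes with the gradient. -/
lemma gradient_mollify {u : R3 → ℝ} {g : R3 → R3} (h : IsWeakGradient u g) (n : ℕ) :
    gradient (mollify n u) = mollify n g := by
  ext1 x
  refine ext_inner_right ℝ fun v => ?_
  set ρ := (mollifier n).normed (volume : Measure R3)
  have hρ : ContDiff ℝ ∞ ρ := (mollifier n).contDiff_normed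
  have hρs : HasCompactSupport ρ := (mollifier n).hasCompactSupport_normed
  have hfd := hρs.hasFDerivAt_convolution_left (lsmul ℝ ℝ) (hρ.of_le (by simp))
    h.locallyIntegrable x
  rw [inner_gradient_left, show fderiv ℝ (mollify n u) x = _ from hfd.fderiv]
  -- The reflected, translated mollifier is itself a test function; reflection supplies the sign
  -- that integration by parts then cancels.
  set φ : R3 → ℝ := fun t => ρ (x - t)
  have hφ : φ ∈ smoothCompactlySupported :=
    ⟨hρ.comp (contDiff_const.sub contDiff_id),
      hρs.comp_homeomorph (Homeomorph.subLeft x)⟩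
  have hφd : ∀ t, fderiv ℝ φ t v = -fderiv ℝ ρ (x - t) v := by
    intro t
    have h1 : HasFDerivAt φ ((fderiv ℝ ρ (x - t)).comp (-ContinuousLinearMap.id ℝ R3)) t :=
      ((hρ.differentiable (by simp)) (x - t)).hasFDerivAt.comp t
        ((hasFDerivAt_id t).const_sub x)
    rw [h1.fderiv]
    simp
  have key := h.integral_eq φ hφ v
  have hi : Integrable (fun t => φ t • g t) volume :=
    h.locallyIntegrable_grad.integrable_smul_left_of_hasCompactSupport hφ.1.continuous hφ.2
  have hR : inner ℝ (mollify n g x) v = ∫ t, φ t * inner ℝ (g t) v := by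
    rw [mollify, convolution_eq_swap, real_inner_comm]
    simp only [ContinuousLinearMap.lsmul_apply]
    rw [← integral_inner hi]
    refine integral_congr_ae (Eventually.of_forall fun t => ?_)
    simp only [real_inner_smul_right, real_inner_comm v]
  have hL : (fderiv ℝ ρ ⋆[(lsmul ℝ ℝ).precompL R3, volume] u) x v =
      -∫ t, u t * fderiv ℝ φ t v := by
    have hex : ConvolutionExistsAt (fderiv ℝ ρ) u x ((lsmul ℝ ℝ).precompL R3) volume :=
      (hρs.fderiv ℝ).convolutionExists_left _ (hρ.continuous_fderiv (by simp))
        h.locallyIntegrable x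
    rw [convolution_eq_swap, ContinuousLinearMap.integral_apply hex.integrable_swap,
      ← integral_neg]
    refine integral_congr_ae (Eventually.of_forall fun t => ?_)
    simp only [hφd]
    simp [ContinuousLinearMap.precompL_apply, mul_comm]
  rw [hL, hR, key, neg_neg]

end IsWeakGradient

/-! ### Cutoffs and approximation by test functions. -/

/-- A cutoff function equal to `1` on the ball of radius `n + 1`. -/
noncomputable def cutoff (n : ℕ) (x : R3) : ℝ :=
  (⟨1, 2, one_pos, one_lt_two⟩ : ContDiffBump (0 : R3)) ((1 / ((n : ℝ) + 1)) • x)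

lemma contDiff_cutoff (n : ℕ) : ContDiff ℝ ∞ (cutoff n) :=
  (ContDiffBump.contDiff _).comp (contDiff_const_smul _)

lemma hasCompactSupport_cutoff (n : ℕ) : HasCompactSupport (cutoff n) :=
  (ContDiffBump.hasCompactSupport _).comp_homeomorph
    (Homeomorph.smulOfNeZero (1 / ((n : ℝ) + 1)) (by positivity))

lemma norm_cutoff_sub_one_le (n : ℕ) (x : R3) : ‖cutoff n x - 1‖ ≤ 1 := by
  have h0 : 0 ≤ cutoff n x := ContDiffBump.nonneg _
  have h1 : cutoff n x ≤ 1 := ContDiffBump.le_one _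
  rw [Real.norm_eq_abs, abs_le]
  constructor <;> linarith

/-- All cutoffs are one bump composed with contractions, so its Lipschitz constant serves every `n`.
-/
lemma exists_norm_gradient_cutoff_le : ∃ C : ℝ, ∀ n x, ‖gradient (cutoff n) x‖ ≤ C := by
  set b : ContDiffBump (0 : R3) := ⟨1, 2, one_pos, one_lt_two⟩
  obtain ⟨C, hC⟩ := (b.contDiff (n := 1)).lipschitzWith_of_hasCompactSupport
    b.hasCompactSupport (by simp)
  refine ⟨C, fun n x => ?_⟩
  have hL : LipschitzWith C (cutoff n) := by
    have h1 : LipschitzWith 1 (fun x : R3 => (1 / ((n : ℝ) + 1)) • x) := by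
      refine LipschitzWith.of_dist_le_mul fun x y => ?_
      rw [dist_smul₀, NNReal.coe_one, Real.norm_of_nonneg (by positivity)]
      gcongr
      rw [div_le_one (by positivity)]
      linarith [(Nat.cast_nonneg n : (0 : ℝ) ≤ n)]
    have h2 := hC.comp h1
    rwa [mul_one] at h2
  rw [gradient, LinearIsometryEquiv.norm_map]
  exact norm_fderiv_le_of_lipschitz ℝ hL

/-- Equality on a neighbourhood, not just at `x`, so that the gradient of the cutoff vanishes at `x`
too. -/
lemma cutoff_eventuallyEq_one (x : R3) : ∀ᶠ n : ℕ in atTop, cutoff n =ᶠ[𝓝 x] fun _ => 1 := by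
  filter_upwards [tendsto_natCast_atTop_atTop.eventually_gt_atTop ‖x‖] with n hn
  have : ∀ᶠ y in 𝓝 x, ‖y‖ < n := (continuous_norm.tendsto x).eventually_lt_const hn
  filter_upwards [this] with y hy
  refine ContDiffBump.one_of_mem_closedBall _ ?_
  rw [mem_closedBall_zero_iff, norm_smul, Real.norm_of_nonneg (by positivity)]
  change 1 / ((n : ℝ) + 1) * ‖y‖ ≤ 1
  rw [one_div_mul_eq_div, div_le_one (by positivity)]
  linarith

/-- Functions in the domain of the energy form are approximated by test functions. -/
lemma IsWeakGradient.exists_smooth_approx {γ : ℝ} (hγ : 0 < γ) {u : R3 → ℝ} {g : R3 → R3}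
    (h : IsWeakGradient u g) (hu : MemLp u 2 (psiMeasure γ)) (hg : MemLp g 2 (psiMeasure γ)) :
    ∃ f : ℕ → R3 → ℝ, (∀ n, f n ∈ smoothCompactlySupported) ∧
      Tendsto (fun n => eLpNorm (f n - u) 2 (psiMeasure γ)) atTop (𝓝 0) ∧
      Tendsto (fun n => eLpNorm (gradient (f n) - g) 2 (psiMeasure γ)) atTop (𝓝 0) := by
  set w : ℕ → R3 → ℝ := fun n x => cutoff n x * u x
  set k : ℕ → R3 → R3 := fun n x => cutoff n x • g x + u x • gradient (cutoff n) x
  have hk : ∀ n, IsWeakGradient (w n) (k n) := fun n => h.smooth_mul (contDiff_cutoff n)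
  have hac := psiMeasure_absolutelyContinuous_volume γ
  obtain ⟨C, hC⟩ := exists_norm_gradient_cutoff_le
  have hwm : ∀ n, AEStronglyMeasurable (w n - u) (psiMeasure γ) := fun n =>
    ((hk n).locallyIntegrable.aestronglyMeasurable.mono_ac hac).sub hu.aestronglyMeasurable
  have hkm : ∀ n, AEStronglyMeasurable (k n - g) (psiMeasure γ) := fun n =>
    ((hk n).locallyIntegrable_grad.aestronglyMeasurable.mono_ac hac).sub hg.aestronglyMeasurable
  have hwle : ∀ n x, ‖(w n - u) x‖ ≤ ‖u x‖ := by
    intro n x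
    have : (w n - u) x = (cutoff n x - 1) * u x := by simp only [w, Pi.sub_apply]; ring
    rw [this, norm_mul]
    exact mul_le_of_le_one_left (norm_nonneg _) (norm_cutoff_sub_one_le n x)
  have hkle : ∀ n x, ‖(k n - g) x‖ ≤ ‖g x‖ + C * ‖u x‖ := by
    intro n x
    have : (k n - g) x = (cutoff n x - 1) • g x + u x • gradient (cutoff n) x := by
      simp only [k, Pi.sub_apply, sub_smul, one_smul]; abel
    rw [this]
    refine (norm_add_le _ _).trans (add_le_add ?_ ?_)
    · rw [norm_smul]
      exact mul_le_of_le_one_left (norm_nonneg _) (norm_cutoff_sub_one_le n x)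
    · rw [norm_smul, mul_comm]
      gcongr
      exact hC n x
  have hGu : MemLp (fun x => ‖u x‖) 2 (psiMeasure γ) := hu.norm
  have hGg : MemLp (fun x => ‖g x‖ + C * ‖u x‖) 2 (psiMeasure γ) :=
    hg.norm.add (hu.norm.const_mul C)
  have hw0 : Tendsto (fun n => eLpNorm (w n - u) 2 (psiMeasure γ)) atTop (𝓝 0) := by
    refine tendsto_eLpNorm_two_of_dominated hwm hGu
      (fun n => Eventually.of_forall (hwle n)) (Eventually.of_forall fun x => ?_)
    refine tendsto_const_nhds.congr' ?_
    filter_upwards [cutoff_eventuallyEq_one x] with n hn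
    simp [w, hn.eq_of_nhds]
  -- A bounded `∇(cutoff n)` is enough here: it is eventually 0 at each point, and `|g| + C|u|`
  -- dominates.
  have hk0 : Tendsto (fun n => eLpNorm (k n - g) 2 (psiMeasure γ)) atTop (𝓝 0) := by
    refine tendsto_eLpNorm_two_of_dominated hkm hGg
      (fun n => Eventually.of_forall (hkle n)) (Eventually.of_forall fun x => ?_)
    refine tendsto_const_nhds.congr' ?_
    filter_upwards [cutoff_eventuallyEq_one x] with n hn
    have : gradient (cutoff n) x = 0 := by
      rw [gradient, hn.fderiv_eq]; simp
    simp [k, hn.eq_of_nhds, this]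
  have hwL : ∀ n, MemLp (w n) 2 (psiMeasure γ) := fun n => by
    have := (hGu.mono (hwm n) (Eventually.of_forall fun x => by simpa using hwle n x)).add hu
    simpa using this
  have hkL : ∀ n, MemLp (k n) 2 (psiMeasure γ) := fun n => by
    have := (hGg.mono (hkm n) (Eventually.of_forall fun x =>
      (hkle n x).trans (le_abs_self _))).add hg
    simpa using this
  -- For each `n`, a single mollification parameter `j` handles both the function and its gradient,
  -- because mollification commutes with the gradient.
  have hstep : ∀ n : ℕ, ∃ f ∈ smoothCompactlySupported,
      eLpNorm (f - w n) 2 (psiMeasure γ) ≤ ENNReal.ofReal (1 / ((n : ℝ) + 1)) ∧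
      eLpNorm (gradient f - k n) 2 (psiMeasure γ) ≤ ENNReal.ofReal (1 / ((n : ℝ) + 1)) := by
    intro n
    have hpos : 0 < ENNReal.ofReal (1 / ((n : ℝ) + 1)) := by
      rw [ENNReal.ofReal_pos]; positivity
    have t1 := tendsto_eLpNorm_mollify_sub hγ (hk n).locallyIntegrable (hwL n)
    have t2 := tendsto_eLpNorm_mollify_sub hγ (hk n).locallyIntegrable_grad (hkL n)
    obtain ⟨j, hj1, hj2⟩ := ((t1.eventually_le_const hpos).and (t2.eventually_le_const hpos)).exists
    refine ⟨mollify j (w n), ⟨contDiff_mollify j (hk n).locallyIntegrable, ?_⟩, hj1, ?_⟩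
    · exact HasCompactSupport.mollify (hasCompactSupport_cutoff n).mul_right j
    · rwa [(hk n).gradient_mollify]
  choose f hf hf1 hf2 using hstep
  have hlim : Tendsto (fun n : ℕ => ENNReal.ofReal (1 / ((n : ℝ) + 1))) atTop (𝓝 0) := by
    simpa using ENNReal.tendsto_ofReal (tendsto_one_div_add_atTop_nhds_zero_nat (𝕜 := ℝ))
  have hfm : ∀ n, AEStronglyMeasurable (f n) (psiMeasure γ) := fun n =>
    (hf n).1.continuous.aestronglyMeasurable
  have hfgm : ∀ n, AEStronglyMeasurable (gradient (f n)) (psiMeasure γ) := fun n =>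
    ((hf n).1.of_le (by simp)).continuous_gradient.aestronglyMeasurable
  refine ⟨f, hf, ?_, ?_⟩
  · refine tendsto_of_tendsto_of_tendsto_of_le_of_le tendsto_const_nhds
      (by simpa only [add_zero] using hlim.add hw0) (fun n => zero_le) fun n => ?_
    rw [← sub_add_sub_cancel (f n) (w n) u]
    refine (eLpNorm_add_le ((hfm n).sub (hwL n).aestronglyMeasurable) (hwm n)
      (by norm_num)).trans ?_
    exact add_le_add (hf1 n) le_rfl
  · refine tendsto_of_tendsto_of_tendsto_of_le_of_le tendsto_const_nhds
      (by simpa only [add_zero] using hlim.add hk0) (fun n => zero_le) fun n => ?_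
    rw [← sub_add_sub_cancel (gradient (f n)) (k n) g]
    refine (eLpNorm_add_le ((hfgm n).sub (hkL n).aestronglyMeasurable) (hkm n)
      (by norm_num)).trans ?_
    exact add_le_add (hf2 n) le_rfl

/-! ### Chain rule and unit contraction. -/

lemma gradient_comp_of_hasDerivAt {Φ η : ℝ → ℝ} (hΦ : ∀ t, HasDerivAt Φ (η t) t) {f : R3 → ℝ}
    (hf : Differentiable ℝ f) :
    gradient (fun x => Φ (f x)) = fun x => η (f x) • gradient f x := by
  ext1 x
  refine ext_inner_right ℝ fun v => ?_
  have h := (hΦ (f x)).comp_hasFDerivAt x (hf x).hasFDerivAt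
  have h' : fderiv ℝ (fun x => Φ (f x)) x = η (f x) • fderiv ℝ f x := h.fderiv
  rw [inner_gradient_left, h', real_inner_smul_left, inner_gradient_left]
  simp

/-- The chain rule. -/
lemma IsWeakGradient.comp {γ : ℝ} (hγ : 0 < γ) {u : R3 → ℝ} {g : R3 → R3}
    (h : IsWeakGradient u g) (hu : MemLp u 2 (psiMeasure γ)) (hg : MemLp g 2 (psiMeasure γ))
    {Φ η : ℝ → ℝ} (hΦ : ∀ t, HasDerivAt Φ (η t) t) (hη : Continuous η) (hη1 : ∀ t, |η t| ≤ 1)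
    (hΦ0 : Φ 0 = 0) :
    IsWeakGradient (fun x => Φ (u x)) (fun x => η (u x) • g x) := by
  have hΦL : LipschitzWith 1 Φ := by
    refine lipschitzWith_of_nnnorm_deriv_le (fun t => (hΦ t).differentiableAt) fun t => ?_
    rw [(hΦ t).deriv, ← NNReal.coe_le_coe]
    simpa using hη1 t
  have hΦle : ∀ s t, ‖Φ s - Φ t‖ ≤ ‖s - t‖ := fun s t => by
    simpa [dist_eq_norm] using hΦL.dist_le_mul s t
  have hΦc : Continuous Φ := hΦL.continuous
  have hΦ1 : ContDiff ℝ 1 Φ := by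
    rw [contDiff_one_iff_deriv]
    refine ⟨fun t => (hΦ t).differentiableAt, ?_⟩
    rwa [show deriv Φ = η from funext fun t => (hΦ t).deriv]
  obtain ⟨f₀, hf₀, hf₀u, hf₀g⟩ := h.exists_smooth_approx hγ hu hg
  -- `η` is merely continuous, so `η (f n) → η (u)` needs almost everywhere convergence, obtained
  -- along a subsequence.
  obtain ⟨ns, hns, hae⟩ := (tendstoInMeasure_of_tendsto_eLpNorm (p := 2) (by norm_num)
    (fun n => (hf₀ n).1.continuous.aestronglyMeasurable) hu.aestronglyMeasurable
    hf₀u).exists_seq_tendsto_ae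
  set f : ℕ → R3 → ℝ := fun n => f₀ (ns n)
  have hf : ∀ n, f n ∈ smoothCompactlySupported := fun n => hf₀ _
  have hfu : Tendsto (fun n => eLpNorm (f n - u) 2 (psiMeasure γ)) atTop (𝓝 0) :=
    hf₀u.comp hns.tendsto_atTop
  have hfg : Tendsto (fun n => eLpNorm (gradient (f n) - g) 2 (psiMeasure γ)) atTop (𝓝 0) :=
    hf₀g.comp hns.tendsto_atTop
  have hηu : AEStronglyMeasurable (fun x => η (u x)) (psiMeasure γ) :=
    hη.comp_aestronglyMeasurable hu.aestronglyMeasurable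
  have hηf : ∀ n, AEStronglyMeasurable (fun x => η (f n x)) (psiMeasure γ) := fun n =>
    (hη.comp (hf n).1.continuous).aestronglyMeasurable
  have hfgm : ∀ n, AEStronglyMeasurable (gradient (f n)) (psiMeasure γ) := fun n =>
    ((hf n).1.of_le (by simp)).continuous_gradient.aestronglyMeasurable
  refine of_tendsto_eLpNorm hγ (u := fun n x => Φ (f n x))
    (g := fun n x => η (f n x) • gradient (f n) x) (fun n => ?_) ?_ ?_ ?_ ?_
  · rw [← gradient_comp_of_hasDerivAt hΦ ((hf n).1.differentiable (by simp))]
    exact of_contDiff (hΦ1.comp ((hf n).1.of_le (by simp)))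
  · refine hu.mono (hΦc.comp_aestronglyMeasurable hu.aestronglyMeasurable)
      (Eventually.of_forall fun x => ?_)
    simpa [hΦ0] using hΦle (u x) 0
  · refine hg.mono (hηu.smul hg.aestronglyMeasurable) (Eventually.of_forall fun x => ?_)
    rw [norm_smul]
    exact mul_le_of_le_one_left (norm_nonneg _) (hη1 _)
  · refine tendsto_of_tendsto_of_tendsto_of_le_of_le tendsto_const_nhds hfu
      (fun n => zero_le) fun n => ?_
    exact eLpNorm_mono fun x => hΦle _ _
  · have hlim2 : Tendsto (fun n => eLpNorm (fun x => (η (f n x) - η (u x)) • g x) 2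
        (psiMeasure γ)) atTop (𝓝 0) := by
      refine tendsto_eLpNorm_two_of_dominated (G := fun x => 2 * ‖g x‖)
        (fun n => ((hηf n).sub hηu).smul hg.aestronglyMeasurable) (hg.norm.const_mul 2)
        (fun n => Eventually.of_forall fun x => ?_) ?_
      · rw [norm_smul]
        gcongr
        refine (norm_sub_le _ _).trans ?_
        have := add_le_add (hη1 (f n x)) (hη1 (u x))
        norm_num at this ⊢
        exact this
      · filter_upwards [hae] with x hx
        have h1 : Tendsto (fun n => η (f n x)) atTop (𝓝 (η (u x))) :=
          (hη.tendsto _).comp hx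
        simpa using (h1.sub_const (η (u x))).smul_const (g x)
    refine tendsto_of_tendsto_of_tendsto_of_le_of_le tendsto_const_nhds
      (by simpa using hfg.add hlim2) (fun n => zero_le) fun n => ?_
    -- The first term is controlled by `|η| ≤ 1` and the convergence of gradients, the second by
    -- dominated convergence.
    have hdec : (fun x => η (f n x) • gradient (f n) x) - (fun x => η (u x) • g x) =
        (fun x => η (f n x) • (gradient (f n) - g) x) +
          fun x => (η (f n x) - η (u x)) • g x := by
      ext1 x
      simp only [Pi.sub_apply, Pi.add_apply, smul_sub, sub_smul]
      abel
    rw [hdec]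
    refine (eLpNorm_add_le ((hηf n).smul ((hfgm n).sub hg.aestronglyMeasurable))
      (((hηf n).sub hηu).smul hg.aestronglyMeasurable) (by norm_num)).trans ?_
    refine add_le_add (eLpNorm_mono fun x => ?_) le_rfl
    rw [Pi.smul_apply', norm_smul]
    exact mul_le_of_le_one_left (norm_nonneg _) (hη1 _)

/-- A continuous approximation of the indicator function of `(0, 1)`. -/
noncomputable def rampIndicator (n : ℕ) (s : ℝ) : ℝ := min 1 (n * max 0 (min s (1 - s)))

lemma continuous_rampIndicator (n : ℕ) : Continuous (rampIndicator n) := by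
  unfold rampIndicator
  fun_prop

lemma abs_rampIndicator_le (n : ℕ) (s : ℝ) : |rampIndicator n s| ≤ 1 := by
  have h : 0 ≤ rampIndicator n s := le_min zero_le_one (by positivity)
  rw [abs_of_nonneg h]
  exact min_le_left _ _

/-- The sequence is eventually constant at every `s`. At `s = 0` and `s = 1` all ramps vanish, which
is why the limit is the indicator of the open interval. -/
lemma tendsto_rampIndicator (s : ℝ) : Tendsto (fun n => rampIndicator n s) atTop
    (𝓝 ((Set.Ioo (0 : ℝ) 1).indicator (fun _ => 1) s)) := by
  refine tendsto_const_nhds.congr' ?_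
  by_cases hs : s ∈ Set.Ioo (0 : ℝ) 1
  · have hpos : 0 < min s (1 - s) := lt_min hs.1 (by linarith [hs.2])
    filter_upwards [(tendsto_natCast_atTop_atTop.atTop_mul_const hpos).eventually_ge_atTop 1]
      with n hn
    rw [Set.indicator_of_mem hs, rampIndicator, max_eq_right hpos.le, min_eq_left hn]
  · have : min s (1 - s) ≤ 0 := by
      rw [Set.mem_Ioo, not_and_or] at hs
      rcases hs with hs | hs
      · exact (min_le_left _ _).trans (not_lt.1 hs)
      · exact (min_le_right _ _).trans (by linarith [not_lt.1 hs])
    filter_upwards with n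
    rw [Set.indicator_of_notMem hs, rampIndicator, max_eq_left this]
    simp

/-- Identifies the unit contraction as the limit of the primitives of the ramps. -/
lemma integral_indicator_Ioo_zero_one (t : ℝ) :
    ∫ s in (0 : ℝ)..t, (Set.Ioo (0 : ℝ) 1).indicator (fun _ => (1 : ℝ)) s =
      min (max 0 t) 1 := by
  rcases le_total 0 t with ht | ht
  · rw [intervalIntegral.integral_of_le ht, setIntegral_indicator measurableSet_Ioo,
      max_eq_right ht, setIntegral_const]
    have : (Set.Ioc 0 t ∩ Set.Ioo (0 : ℝ) 1 : Set ℝ) =ᵐ[volume] (Set.Ioc 0 (min t 1) : Set ℝ) := by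
      have h1 : Set.Ioc 0 (min t 1) = Set.Ioc 0 t ∩ Set.Ioc (0 : ℝ) 1 := by
        rw [Set.Ioc_inter_Ioc]; simp
      rw [h1]
      exact ae_eq_set_inter (ae_eq_refl _) Ioo_ae_eq_Ioc
    rw [measureReal_congr this]
    simp [ht]
  · rw [intervalIntegral.integral_of_ge ht, setIntegral_indicator measurableSet_Ioo,
      max_eq_left ht]
    have : Set.Ioc t 0 ∩ Set.Ioo (0 : ℝ) 1 = ∅ := by
      ext s; simp only [Set.mem_inter_iff, Set.mem_Ioc, Set.mem_Ioo, Set.mem_empty_iff_false]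
      constructor
      · rintro ⟨⟨_, h1⟩, h2, _⟩
        linarith
      · exact False.elim
    simp [this]

/-- The chain rule for the unit contraction. -/
lemma IsWeakGradient.unitContraction {γ : ℝ} (hγ : 0 < γ) {u : R3 → ℝ} {g : R3 → R3}
    (h : IsWeakGradient u g) (hu : MemLp u 2 (psiMeasure γ)) (hg : MemLp g 2 (psiMeasure γ)) :
    MemLp (fun x => min (max 0 (u x)) 1) 2 (psiMeasure γ) ∧
    MemLp (fun x => (Set.Ioo (0 : ℝ) 1).indicator (fun _ => (1 : ℝ)) (u x) • g x) 2
      (psiMeasure γ) ∧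
    IsWeakGradient (fun x => min (max 0 (u x)) 1)
      (fun x => (Set.Ioo (0 : ℝ) 1).indicator (fun _ => (1 : ℝ)) (u x) • g x) := by
  set η : ℝ → ℝ := (Set.Ioo (0 : ℝ) 1).indicator (fun _ => (1 : ℝ))
  have hηm : Measurable η := measurable_const.indicator measurableSet_Ioo
  have hη1 : ∀ t, ‖η t‖ ≤ 1 := fun t => by
    by_cases ht : t ∈ Set.Ioo (0 : ℝ) 1 <;> simp [η, ht]
  have hηu : AEStronglyMeasurable (fun x => η (u x)) (psiMeasure γ) :=
    (hηm.comp_aemeasurable hu.aestronglyMeasurable.aemeasurable).aestronglyMeasurable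
  have hclip : Continuous fun t : ℝ => min (max 0 t) 1 := by fun_prop
  have hclip_le : ∀ t : ℝ, ‖min (max 0 t) 1‖ ≤ ‖t‖ := fun t => by
    rw [Real.norm_of_nonneg (by positivity)]
    exact (min_le_left _ _).trans (max_le (norm_nonneg _) (le_abs_self _))
  have hu1 : MemLp (fun x => min (max 0 (u x)) 1) 2 (psiMeasure γ) :=
    hu.mono (hclip.comp_aestronglyMeasurable hu.aestronglyMeasurable)
      (Eventually.of_forall fun x => hclip_le _)
  have hg1 : MemLp (fun x => η (u x) • g x) 2 (psiMeasure γ) := by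
    refine hg.mono (hηu.smul hg.aestronglyMeasurable) (Eventually.of_forall fun x => ?_)
    rw [norm_smul]
    exact mul_le_of_le_one_left (norm_nonneg _) (hη1 _)
  refine ⟨hu1, hg1, ?_⟩
  set Φ : ℕ → ℝ → ℝ := fun n t => ∫ s in (0 : ℝ)..t, rampIndicator n s
  have hΦ : ∀ n t, HasDerivAt (Φ n) (rampIndicator n t) t := fun n t =>
    (continuous_rampIndicator n).integral_hasStrictDerivAt 0 t |>.hasDerivAt
  have hΦle : ∀ n t, ‖Φ n t‖ ≤ ‖t‖ := fun n t => by
    have := intervalIntegral.norm_integral_le_of_norm_le_const (a := 0) (b := t)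
      (f := rampIndicator n) (C := 1) (fun s _ => abs_rampIndicator_le n s)
    simpa using this
  have hΦc : ∀ n, Continuous (Φ n) := fun n =>
    continuous_iff_continuousAt.2 fun t => (hΦ n t).continuousAt
  have hΦlim : ∀ t, Tendsto (fun n => Φ n t) atTop (𝓝 (min (max 0 t) 1)) := by
    intro t
    rw [← integral_indicator_Ioo_zero_one]
    refine intervalIntegral.tendsto_integral_filter_of_dominated_convergence (fun _ => 1)
      (Eventually.of_forall fun n => (continuous_rampIndicator n).aestronglyMeasurable)
      (Eventually.of_forall fun n => Eventually.of_forall fun s _ => abs_rampIndicator_le n s)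
      intervalIntegrable_const (Eventually.of_forall fun s _ => tendsto_rampIndicator s)
  -- The ramps converge at every value of `u`, so no separate argument is needed that `∇u` vanishes
  -- almost everywhere on `{u = 0}` and `{u = 1}`.
  refine of_tendsto_eLpNorm hγ (u := fun n x => Φ n (u x))
    (g := fun n x => rampIndicator n (u x) • g x)
    (fun n => h.comp hγ hu hg (hΦ n) (continuous_rampIndicator n) (abs_rampIndicator_le n)
      (by simp [Φ])) hu1 hg1 ?_ ?_
  · refine tendsto_eLpNorm_two_of_dominated (G := fun x => 2 * ‖u x‖) (fun n =>
      ((hΦc n).comp_aestronglyMeasurable hu.aestronglyMeasurable).sub hu1.aestronglyMeasurable)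
      (hu.norm.const_mul 2) (fun n => Eventually.of_forall fun x => ?_)
      (Eventually.of_forall fun x => ?_)
    · refine (norm_sub_le _ _).trans ?_
      linarith [hΦle n (u x), hclip_le (u x)]
    · simpa using (hΦlim (u x)).sub_const (min (max 0 (u x)) 1)
  · refine tendsto_eLpNorm_two_of_dominated (G := fun x => 2 * ‖g x‖) (fun n =>
      (((continuous_rampIndicator n).comp_aestronglyMeasurable hu.aestronglyMeasurable).smul
        hg.aestronglyMeasurable).sub hg1.aestronglyMeasurable)
      (hg.norm.const_mul 2) (fun n => Eventually.of_forall fun x => ?_)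
      (Eventually.of_forall fun x => ?_)
    · rw [Pi.sub_apply, ← sub_smul, norm_smul]
      gcongr
      refine (norm_sub_le _ _).trans ?_
      have h1 : ‖rampIndicator n (u x)‖ ≤ 1 := abs_rampIndicator_le n _
      linarith [hη1 (u x)]
    · have := ((tendsto_rampIndicator (u x)).smul_const (g x)).sub_const (η (u x) • g x)
      simpa [η] using this

/-! ### The Dirichlet form and its core. -/

section form

variable {γ : ℝ} {hγ : 0 < γ}

lemma weakGradient_ae_eq (u : weightedDomain γ hγ) {g : R3 → R3}
    (h : IsWeakGradient (u : Lp ℝ 2 (psiMeasure γ)) g) : weakGradient u =ᵐ[psiMeasure γ] g :=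
  (psiMeasure_absolutelyContinuous_volume γ).ae_eq ((weakGradient_spec u).unique h)

lemma exists_weightedDomain (hγ : 0 < γ) {f : R3 → ℝ} {g : R3 → R3} (h : IsWeakGradient f g)
    (hf : MemLp f 2 (psiMeasure γ)) (hg : MemLp g 2 (psiMeasure γ)) :
    ∃ v : weightedDomain γ hγ, ((v : Lp ℝ 2 (psiMeasure γ)) : R3 → ℝ) =ᵐ[psiMeasure γ] f ∧
      weakGradient v =ᵐ[psiMeasure γ] g := by
  have h' : IsWeakGradient (hf.toLp : Lp ℝ 2 (psiMeasure γ)) g :=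
    h.congr ((volume_absolutelyContinuous_psiMeasure hγ).ae_eq hf.coeFn_toLp.symm)
  exact ⟨⟨hf.toLp, g, h', hg⟩, hf.coeFn_toLp, weakGradient_ae_eq _ h'⟩

/-- The class in `L²(ψ_γ² dx)` of the distributional gradient. -/
noncomputable def gradientLp (u : weightedDomain γ hγ) : Lp R3 2 (psiMeasure γ) :=
  (memLp_weakGradient u).toLp

lemma gradientLp_add (u v : weightedDomain γ hγ) :
    gradientLp (u + v) = gradientLp u + gradientLp v := by
  unfold gradientLp
  rw [← MemLp.toLp_add]
  exact MemLp.toLp_congr _ _ (weakGradient_add u v)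

lemma gradientLp_sub (u v : weightedDomain γ hγ) :
    gradientLp (u - v) = gradientLp u - gradientLp v := by
  rw [eq_sub_iff_add_eq, ← gradientLp_add, sub_add_cancel]

lemma weightedEnergy_self (u : weightedDomain γ hγ) :
    weightedEnergy u u = 1 / 2 * ‖gradientLp u‖ ^ 2 := by
  rw [weightedEnergy, ← real_inner_self_eq_norm_sq, L2.inner_def]
  congr 1
  refine integral_congr_ae ?_
  filter_upwards [(memLp_weakGradient u).coeFn_toLp] with x hx
  rw [gradientLp, hx]

lemma weightedEnergy_self_nonneg (u : weightedDomain γ hγ) : 0 ≤ weightedEnergy u u := by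
  rw [weightedEnergy_self]
  positivity

/-- Exhibits the `E₁`-norm as a graph norm of the gradient, reducing completeness to that of two
`L²` spaces and closedness of the gradient. -/
lemma weightedForm_energyOne (u : weightedDomain γ hγ) :
    (weightedForm γ hγ).energyOne u =
      1 / 2 * ‖gradientLp u‖ ^ 2 + ‖(u : Lp ℝ 2 (psiMeasure γ))‖ ^ 2 := by
  rw [← weightedEnergy_self, ← real_inner_self_eq_norm_sq]
  rfl

lemma norm_eq_toReal_eLpNorm_of_ae_eq {X E : Type*} [MeasurableSpace X] [NormedAddCommGroup E]
    {μ : Measure X} (u : Lp E 2 μ) {f : X → E} (h : u =ᵐ[μ] f) :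
    ‖u‖ = (eLpNorm f 2 μ).toReal := by
  rw [Lp.norm_def, eLpNorm_congr_ae h]

lemma memLp_psiMeasure_of_hasCompactSupport {E : Type*} [NormedAddCommGroup E] (hγ : 0 < γ)
    {f : R3 → E} (hf : Continuous f) (hs : HasCompactSupport f) : MemLp f 2 (psiMeasure γ) := by
  have := isFiniteMeasure_psiMeasure hγ
  exact hf.memLp_of_hasCompactSupport hs

lemma hasCompactSupport_gradient {f : R3 → ℝ} (hf : HasCompactSupport f) :
    HasCompactSupport (gradient f) :=
  (hf.fderiv ℝ).comp_left (map_zero _)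

lemma exists_weightedDomain_of_smooth (hγ : 0 < γ) {f : R3 → ℝ}
    (hf : f ∈ smoothCompactlySupported) :
    ∃ v : weightedDomain γ hγ, ((v : Lp ℝ 2 (psiMeasure γ)) : R3 → ℝ) =ᵐ[psiMeasure γ] f ∧
      weakGradient v =ᵐ[psiMeasure γ] gradient f := by
  have hf1 : ContDiff ℝ 1 f := hf.1.of_le (by simp)
  exact exists_weightedDomain hγ (IsWeakGradient.of_contDiff hf1)
    (memLp_psiMeasure_of_hasCompactSupport hγ hf1.continuous hf.2)
    (memLp_psiMeasure_of_hasCompactSupport hγ hf1.continuous_gradient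
      (hasCompactSupport_gradient hf.2))

lemma dense_weightedDomain (hγ : 0 < γ) :
    Dense (weightedDomain γ hγ : Set (Lp ℝ 2 (psiMeasure γ))) := by
  have := isFiniteMeasure_psiMeasure hγ
  refine (Lp.dense_hasCompactSupport_contDiff (F := ℝ) (μ := psiMeasure γ) (p := 2)
    (by norm_num)).mono ?_
  rintro u ⟨f, huf, hs, hc⟩
  obtain ⟨v, hv, -⟩ := exists_weightedDomain_of_smooth hγ (f := f) ⟨hc, hs⟩
  have : u = v := Lp.ext (huf.trans hv.symm)
  rw [this]
  exact v.2

/-- The energy form is closed. -/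
lemma weightedForm_closed (u : ℕ → weightedDomain γ hγ)
    (hu : ∀ ε > 0, ∃ N, ∀ m ≥ N, ∀ n ≥ N, (weightedForm γ hγ).energyOne (u m - u n) < ε) :
    ∃ v : weightedDomain γ hγ,
      Tendsto (fun n => (weightedForm γ hγ).energyOne (u n - v)) atTop (𝓝 0) := by
  have hcoe : ∀ a b : weightedDomain γ hγ, ((a - b : weightedDomain γ hγ) :
      Lp ℝ 2 (psiMeasure γ)) = (a : Lp ℝ 2 (psiMeasure γ)) - b := fun a b => rfl
  have hc1 : CauchySeq fun n => (u n : Lp ℝ 2 (psiMeasure γ)) := by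
    refine Metric.cauchySeq_iff.2 fun ε hε => ?_
    obtain ⟨N, hN⟩ := hu (ε ^ 2 / 2) (by positivity)
    refine ⟨N, fun m hm n hn => ?_⟩
    have := hN m hm n hn
    have h2 := weightedForm_energyOne (u m - u n)
    rw [hcoe] at h2
    rw [dist_eq_norm]
    refine lt_of_pow_lt_pow_left₀ 2 hε.le ?_
    have : (weightedForm γ hγ).energyOne (u m - u n) < ε ^ 2 / 2 := this
    nlinarith [sq_nonneg ‖gradientLp (u m - u n)‖, sq_nonneg ε]
  have hc2 : CauchySeq fun n => gradientLp (u n) := by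
    refine Metric.cauchySeq_iff.2 fun ε hε => ?_
    -- `ε² / 2` compensates the factor `1/2` in front of the gradient norm.
    obtain ⟨N, hN⟩ := hu (ε ^ 2 / 2) (by positivity)
    refine ⟨N, fun m hm n hn => ?_⟩
    have := hN m hm n hn
    have h2 := weightedForm_energyOne (u m - u n)
    rw [dist_eq_norm, ← gradientLp_sub]
    refine lt_of_pow_lt_pow_left₀ 2 hε.le ?_
    have : (weightedForm γ hγ).energyOne (u m - u n) < ε ^ 2 / 2 := this
    nlinarith [sq_nonneg ‖((u m - u n : weightedDomain γ hγ) : Lp ℝ 2 (psiMeasure γ))‖]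
  obtain ⟨U, hU⟩ := cauchySeq_tendsto_of_complete hc1
  obtain ⟨G, hG⟩ := cauchySeq_tendsto_of_complete hc2
  have hUG : IsWeakGradient U G := by
    refine IsWeakGradient.of_tendsto_eLpNorm hγ (fun n => weakGradient_spec (u n))
      (Lp.memLp U) (Lp.memLp G) ((Lp.tendsto_Lp_iff_tendsto_eLpNorm' _ _).1 hU) ?_
    refine ((Lp.tendsto_Lp_iff_tendsto_eLpNorm' _ _).1 hG).congr fun n => ?_
    refine eLpNorm_congr_ae ?_
    filter_upwards [(memLp_weakGradient (u n)).coeFn_toLp] with x hx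
    rw [Pi.sub_apply, Pi.sub_apply, gradientLp, hx]
  let v : weightedDomain γ hγ := ⟨U, G, hUG, Lp.memLp G⟩
  have hvG : gradientLp v = G := by
    refine Lp.ext ?_
    exact (memLp_weakGradient v).coeFn_toLp.trans (weakGradient_ae_eq v hUG)
  refine ⟨v, ?_⟩
  have e : ∀ n, (weightedForm γ hγ).energyOne (u n - v) =
      1 / 2 * ‖gradientLp (u n) - G‖ ^ 2 + ‖(u n : Lp ℝ 2 (psiMeasure γ)) - U‖ ^ 2 := by
    intro n
    rw [← hvG, ← gradientLp_sub]
    exact weightedForm_energyOne (u n - v)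
  simp only [e]
  have l1 := ((tendsto_iff_norm_sub_tendsto_zero.1 hG).pow 2).const_mul (1 / 2 : ℝ)
  have l2 := (tendsto_iff_norm_sub_tendsto_zero.1 hU).pow 2
  simpa using l1.add l2

/-- The unit contraction operates on the energy form. -/
lemma weightedForm_markov (u : weightedDomain γ hγ) : ∃ v : weightedDomain γ hγ,
    ((v : Lp ℝ 2 (psiMeasure γ)) : R3 → ℝ) =ᵐ[psiMeasure γ]
      (fun x => min (max 0 ((u : Lp ℝ 2 (psiMeasure γ)) x)) 1) ∧
    weightedEnergy v v ≤ weightedEnergy u u := by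
  obtain ⟨h1, h2, h3⟩ := (weakGradient_spec u).unitContraction hγ (Lp.memLp _)
    (memLp_weakGradient u)
  obtain ⟨v, hv1, hv2⟩ := exists_weightedDomain hγ h3 h1 h2
  refine ⟨v, hv1, ?_⟩
  unfold weightedEnergy
  refine mul_le_mul_of_nonneg_left ?_ (by norm_num)
  refine integral_mono_ae (integrable_inner_weakGradient v v)
    (integrable_inner_weakGradient u u) ?_
  filter_upwards [hv2] with x hx
  rw [hx]
  -- The gradient of the contracted function is `∇u` in one case and 0 in the other, so the energy
  -- densities compare pointwise.
  by_cases ht : (u : Lp ℝ 2 (psiMeasure γ)) x ∈ Set.Ioo (0 : ℝ) 1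
  · simp [Set.indicator_of_mem ht]
  · simp [Set.indicator_of_notMem ht]

lemma isDirichletForm_weightedForm (γ : ℝ) (hγ : 0 < γ) : (weightedForm γ hγ).IsDirichletForm where
  dense := dense_weightedDomain hγ
  symm u v := weightedEnergy_comm u v
  nonneg := weightedEnergy_self_nonneg
  closed := weightedForm_closed
  markov := weightedForm_markov

lemma exists_smooth_energyOne_sub_lt (u : weightedDomain γ hγ) (ε : ℝ) (hε : 0 < ε) :
    ∃ f ∈ smoothCompactlySupported, ∃ v : weightedDomain γ hγ,
      ((v : Lp ℝ 2 (psiMeasure γ)) : R3 → ℝ) =ᵐ[psiMeasure γ] f ∧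
        (weightedForm γ hγ).energyOne (u - v) < ε := by
  obtain ⟨f, hf, hfu, hfg⟩ := (weakGradient_spec u).exists_smooth_approx hγ (Lp.memLp _)
    (memLp_weakGradient u)
  choose v hv hvg using fun n => exists_weightedDomain_of_smooth hγ (hf n)
  have e : ∀ n, (weightedForm γ hγ).energyOne (u - v n) =
      1 / 2 * (eLpNorm (gradient (f n) - weakGradient u) 2 (psiMeasure γ)).toReal ^ 2 +
        (eLpNorm (f n - ⇑(u : Lp ℝ 2 (psiMeasure γ))) 2 (psiMeasure γ)).toReal ^ 2 := by
    intro n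
    refine (weightedForm_energyOne (u - v n)).trans ?_
    have n1 : ‖gradientLp (u - v n)‖ =
        (eLpNorm (gradient (f n) - weakGradient u) 2 (psiMeasure γ)).toReal := by
      rw [gradientLp_sub, norm_sub_rev]
      refine norm_eq_toReal_eLpNorm_of_ae_eq _ ?_
      filter_upwards [Lp.coeFn_sub (gradientLp (v n)) (gradientLp u),
        (memLp_weakGradient u).coeFn_toLp, (memLp_weakGradient (v n)).coeFn_toLp, hvg n]
        with x h1 h2 h3 h4
      rw [h1, Pi.sub_apply, Pi.sub_apply, gradientLp, gradientLp, h2, h3, h4]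
    have n2 : ‖((u - v n : weightedDomain γ hγ) : Lp ℝ 2 (psiMeasure γ))‖ =
        (eLpNorm (f n - ⇑(u : Lp ℝ 2 (psiMeasure γ))) 2 (psiMeasure γ)).toReal := by
      rw [Submodule.coe_sub, norm_sub_rev]
      refine norm_eq_toReal_eLpNorm_of_ae_eq _ ?_
      filter_upwards [Lp.coeFn_sub (v n : Lp ℝ 2 (psiMeasure γ)) u, hv n] with x h1 h2
      rw [h1, Pi.sub_apply, Pi.sub_apply, h2]
    rw [n1, n2]
  have hlim : Tendsto (fun n => (weightedForm γ hγ).energyOne (u - v n)) atTop (𝓝 0) := by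
    simp only [e]
    have l1 := (((ENNReal.tendsto_toReal ENNReal.zero_ne_top).comp hfg).pow 2).const_mul
      (1 / 2 : ℝ)
    have l2 := ((ENNReal.tendsto_toReal ENNReal.zero_ne_top).comp hfu).pow 2
    simpa [Function.comp_def] using l1.add l2
  obtain ⟨n, hn⟩ := (hlim.eventually_lt_const hε).exists
  exact ⟨f n, hf n, v n, hv n, hn⟩

lemma isCore_weightedForm (γ : ℝ) (hγ : 0 < γ) :
    (weightedForm γ hγ).IsCore smoothCompactlySupported where
  continuous f hf := hf.1.continuous
  hasCompactSupport f hf := hf.2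
  mem_domain f hf := by
    obtain ⟨v, hv, -⟩ := exists_weightedDomain_of_smooth hγ hf
    exact ⟨v, hv⟩
  dense_domain := exists_smooth_energyOne_sub_lt
  dense_uniform f hf hs ε hε := by
    obtain ⟨n, hn⟩ := (exists_dist_mollify_le hf hs (half_pos hε)).exists
    refine ⟨mollify n f, ⟨contDiff_mollify n hf.locallyIntegrable, hs.mollify n⟩, fun x => ?_⟩
    have := hn x
    rw [dist_comm, Real.dist_eq] at this
    linarith

end form

theorem theorem1 (γ : ℝ) (hγ : 0 < γ) :
    (weightedForm γ hγ).IsRegularDirichletForm ∧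
      (weightedForm γ hγ).IsCore smoothCompactlySupported := by
  have := isFiniteMeasure_psiMeasure hγ
  -- Regularity follows from finiteness of the Borel measure `m` on `ℝ³`; full support follows since
  -- Lebesgue measure is absolutely continuous with respect to `m`.
  exact ⟨⟨inferInstance, (volume_absolutelyContinuous_psiMeasure hγ).isOpenPosMeasure,
    isDirichletForm_weightedForm γ hγ, _, isCore_weightedForm γ hγ⟩, isCore_weightedForm γ hγ⟩
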